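/- Let $M$ be a smooth supermanifold of dimension $d|s$ with local coordinates $Z^i$ of parity $i\in\mathbb Z/2$. Signs such as $(-)^{ij}$ are formed from parities. Let $(V,F)$ be a section of $TM\oplus T^*M$ of parity $p$: $V=V^i\partial_i$ is a vector field of parity $p$ and $F=dZ^iF_i(-)^{ip}$ a one-form of parity $p$, with $F_i=F(\partial_i)$. In terms of the string fields $Z^i(\sigma)$ and their conjugate momenta $P_i(\sigma)$, its current is $$j_{(V,F)}=V^iP_i+F_i\,\partial_\sigma Z^i(-)^i .$$ Let $\{\cdot,\cdot\}$ be the graded equal-time Poisson bracket on local expressions in the fields, normalized by $\{P_i(\sigma_1),Z^j(\sigma_2)\}=\delta_i^j\,\delta(\sigma_1-\sigma_2)$, $\{Z^i,Z^j\}=\{P_i,P_j\}=0$. Differential forms are $\mathbb Z\times\mathbb Z_2$-graded, $d$ is the left exterior derivative, of degree $(1,0)$, $\iota_V$ has degree $(-1,|V|)$ with $\iota_V(dZ^i\rho_i)=V^i\rho_i$, $\mathcal L_V=\iota_Vd+d\iota_V$, and $[V_1,V_2]$ is the super Lie bracket. (1) For sections $(V_1,F_1)$, $(V_2,F_2)$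 of parities $p_1,p_2$, in every coordinate chart and in the sense of distributions in $\sigma_1$ (with values in local expressions at $\sigma_2$), $$\{j_{(V_1,F_1)}(\sigma_1),j_{(V_2,F_2)}(\sigma_2)\}=j_{[\![(V_1,F_1),(V_2,F_2)]\!]}(\sigma_2)\,\delta(\sigma_1-\sigma_2)-\langle(V_1,F_1),(V_2,F_2)\rangle(\sigma_2)\,\delta'(\sigma_1-\sigma_2),$$ where $$[\![(V_1,F_1),(V_2,F_2)]\!]=\bigl([V_1,V_2],\ \mathcal L_{V_1}F_2-(-)^{p_1p_2}\iota_{V_2}dF_1\bigr),\qquad \langle(V_1,F_1),(V_2,F_2)\rangle=\iota_{V_1}F_2+(-)^{p_1p_2}\iota_{V_2}F_1 .$$ (2) If $(Q,F)$ is a section of odd parity, then, in every coordinate chart, the fermionic current $j_{(Q,F)}$ is nilpotent, i.e. $\{j_{(Q,F)}(\sigma_1),j_{(Q,F)}(\sigma_2)\}=0$, if and only if $$[Q,Q]=0\qquad\text{and}\qquad \mathcal L_QF+\iota_QdF=0 .$$ -/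

import Mathlib

open TopologicalSpace CategoryTheory Opposite
open scoped TensorProduct ContDiff Distributions

noncomputable section

namespace SuperSigma

/-! ### Signs -/

/-- The sign `(-)^{p q}` of two parities. -/
def ksign (p q : ZMod 2) : ℝ := if p = 1 ∧ q = 1 then -1 else 1

/-! ### Superdomains -/

section Superdomain

variable {α : Type} [Fintype α]

/-- The algebra `C^∞(W)` of real smooth functions on an open subset `W` of `ℝ^α`. -/
def smoothFn (W : Opens (α → ℝ)) : Subalgebra ℝ (W → ℝ) where
  carrier := {f | ∃ g : (α → ℝ) → ℝ, ContDiffOn ℝ ∞ g W ∧ ∀ w : W, g w = f w}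
  mul_mem' := by
    rintro f f' ⟨g, hg, h⟩ ⟨g', hg', h'⟩
    exact ⟨fun x => g x * g' x, hg.mul hg', fun w => by simp [h, h']⟩
  add_mem' := by
    rintro f f' ⟨g, hg, h⟩ ⟨g', hg', h'⟩
    exact ⟨fun x => g x + g' x, hg.add hg', fun w => by simp [h, h']⟩
  algebraMap_mem' r := ⟨fun _ => r, contDiffOn_const, fun _ => rfl⟩

/-- Extension by zero of a smooth function on `W` to all of `ℝ^α`. -/
def zeroExt {W : Opens (α → ℝ)} (f : smoothFn W) : (α → ℝ) → ℝ :=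
  Function.extend Subtype.val f.1 0

theorem zeroExt_apply {W : Opens (α → ℝ)} (f : smoothFn W) (w : W) : zeroExt f w = f.1 w :=
  Subtype.val_injective.extend_apply _ _ _

theorem contDiffOn_zeroExt {W : Opens (α → ℝ)} (f : smoothFn W) :
    ContDiffOn ℝ ∞ (zeroExt f) W := by
  obtain ⟨g, hg, h⟩ := f.2
  exact hg.congr fun x hx => by rw [zeroExt_apply f ⟨x, hx⟩, ← h ⟨x, hx⟩]

theorem differentiableAt_zeroExt {W : Opens (α → ℝ)} (f : smoothFn W) (w : W) :
    DifferentiableAt ℝ (zeroExt f) w :=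
  ((contDiffOn_zeroExt f).contDiffAt (W.isOpen.mem_nhds w.2)).differentiableAt (by simp)

/-- The partial derivative `∂/∂x^a` on `C^∞(W)`. -/
def smoothDeriv [DecidableEq α] (W : Opens (α → ℝ)) (a : α) :
    smoothFn W →ₗ[ℝ] smoothFn W where
  toFun f := ⟨fun w => fderiv ℝ (zeroExt f) w (Pi.single a 1),
    fun x => fderiv ℝ (zeroExt f) x (Pi.single a 1),
    ((contDiffOn_zeroExt f).fderiv_of_isOpen W.isOpen (m := ∞) (by simp)).clm_apply
      contDiffOn_const, fun _ => rfl⟩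
  map_add' f g := by
    ext w
    have h : zeroExt (f + g) = zeroExt f + zeroExt g := by
      rw [zeroExt, zeroExt, zeroExt, ← Function.extend_add]; simp
    change fderiv ℝ (zeroExt (f + g)) w _ = fderiv ℝ (zeroExt f) w _ + fderiv ℝ (zeroExt g) w _
    rw [h, fderiv_add (differentiableAt_zeroExt f w) (differentiableAt_zeroExt g w)]
    rfl
  map_smul' r f := by
    ext w
    have h : zeroExt (r • f) = r • zeroExt f := by
      rw [zeroExt, zeroExt, ← Function.extend_smul]; simp
    change fderiv ℝ (zeroExt (r • f)) w _ = r • fderiv ℝ (zeroExt f) w _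
    rw [h, fderiv_const_smul (differentiableAt_zeroExt f w)]
    rfl

/-- Pull-back of smooth functions along the coordinate projection `w' ↦ w' ∘ e`. -/
def smoothPull {α' : Type} [Fintype α'] {W : Opens (α → ℝ)} {W' : Opens (α' → ℝ)}
    (e : α → α') (h : ∀ w ∈ W', w ∘ e ∈ W) : smoothFn W →ₐ[ℝ] smoothFn W' where
  toFun f := ⟨fun w => f.1 ⟨w.1 ∘ e, h _ w.2⟩, by
    obtain ⟨g, hg, hf⟩ := f.2
    refine ⟨fun w => g (w ∘ e), ?_, fun w => hf ⟨w.1 ∘ e, h _ w.2⟩⟩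
    exact hg.comp (contDiffOn_pi.2 fun i => (contDiff_apply ℝ ℝ (e i)).contDiffOn) h⟩
  map_one' := rfl
  map_mul' _ _ := rfl
  map_zero' := rfl
  map_add' _ _ := rfl
  commutes' _ := rfl

/-- The superalgebra `C^∞(W) ⊗ Λ[θ^b, b ∈ β]` of superfunctions on the superdomain with body
`W ⊆ ℝ^α` and odd coordinates indexed by `β`. -/
abbrev SuperFn (W : Opens (α → ℝ)) (β : Type) : Type :=
  smoothFn W ⊗[ℝ] ExteriorAlgebra ℝ (β →₀ ℝ)

variable {β : Type}

/-- The parity involution: `+1` on even and `-1` on odd superfunctions. -/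
def parityInv (W : Opens (α → ℝ)) (β : Type) : SuperFn W β →ₗ[ℝ] SuperFn W β :=
  LinearMap.lTensor _ (CliffordAlgebra.involute (Q := (0 : QuadraticForm ℝ (β →₀ ℝ)))).toLinearMap

/-- `f` is homogeneous of parity `p`. -/
def HasParity {W : Opens (α → ℝ)} (f : SuperFn W β) (p : ZMod 2) : Prop :=
  parityInv W β f = ksign p p • f

/-- A smooth function seen as an even superfunction. -/
def ofSmooth {W : Opens (α → ℝ)} (f : smoothFn W) : SuperFn W β := f ⊗ₜ 1

/-- The coordinate superfunctions: `x^a` for `inl a` and `θ^b` for `inr b`. -/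
def coord (W : Opens (α → ℝ)) : α ⊕ β → SuperFn W β
  | .inl a => ofSmooth ⟨fun w => w.1 a, fun x => x a,
      (contDiff_apply ℝ ℝ a).contDiffOn, fun _ => rfl⟩
  | .inr b => 1 ⊗ₜ ExteriorAlgebra.ι ℝ (Finsupp.single b 1)

/-- The parity of a coordinate index. -/
def par : α ⊕ β → ZMod 2
  | .inl _ => 0
  | .inr _ => 1

/-- The left partial derivatives `∂/∂x^a` (acting on coefficients) and `∂/∂θ^b` (the left
antiderivation of the exterior algebra with `∂θ^c/∂θ^b = δ_b^c`). -/
def pd [DecidableEq α] {W : Opens (α → ℝ)} : α ⊕ β → SuperFn W β →ₗ[ℝ] SuperFn W β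
  | .inl a => LinearMap.rTensor _ (smoothDeriv W a)
  | .inr b => LinearMap.lTensor _
      (CliffordAlgebra.contractLeft (Q := (0 : QuadraticForm ℝ (β →₀ ℝ))) (Finsupp.lapply b))

/-- The right partial derivatives, `f ←∂_i = (-)^{i(|f|+1)} ∂_i f`. -/
def pdR [DecidableEq α] {W : Opens (α → ℝ)} : α ⊕ β → SuperFn W β →ₗ[ℝ] SuperFn W β
  | .inl a => pd (.inl a)
  | .inr b => parityInv W β ∘ₗ pd (.inr b)

/-- Pull-back of superfunctions along a coordinate projection: the coordinate with index `a` is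
sent to the coordinate with index `e a`, and `θ^b` to `θ^{o b}`. -/
def pull {α' : Type} [Fintype α'] {β' : Type} {W : Opens (α → ℝ)} {W' : Opens (α' → ℝ)}
    (e : α → α') (o : β → β') (h : ∀ w ∈ W', w ∘ e ∈ W) : SuperFn W β →ₐ[ℝ] SuperFn W' β' :=
  Algebra.TensorProduct.map (smoothPull e h) (ExteriorAlgebra.map (Finsupp.lmapDomain ℝ ℝ o))

/-- Restriction of superfunctions to a smaller superdomain. -/
def restrict {W W' : Opens (α → ℝ)} (h : W' ≤ W) : SuperFn W β →ₐ[ℝ] SuperFn W' β :=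
  pull id id fun _ hw => h hw

end Superdomain

/-! ### Tensor calculus on a superdomain of dimension `d|s` -/

section Calculus

variable {d s : ℕ}

/-- Indices `i = 1,…,d|1,…,s` of the coordinates `Z^i`. -/
abbrev Idx (d s : ℕ) : Type := Fin d ⊕ Fin s

variable {U : Opens (Fin d → ℝ)}

/-- A pair of a vector field `V = V^i ∂_i` and a one-form `F = dZ^i ρ_i` in coordinates. The
one-form is stored through its right coefficients `ρ_i = ι_{∂_i} F`. -/
structure LocalPair (U : Opens (Fin d → ℝ)) (s : ℕ) where
  vec : Idx d s → SuperFn U (Fin s)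
  form : Idx d s → SuperFn U (Fin s)

/-- The pair is homogeneous of parity `p`: both the vector field and the one-form have parity `p`
(the exterior derivative is even, so `dZ^i` has the parity of `Z^i`). -/
def LocalPair.IsHomogeneous (S : LocalPair U s) (p : ZMod 2) : Prop :=
  ∀ i, HasParity (S.vec i) (p + par i) ∧ HasParity (S.form i) (p + par i)

/-- The value `F_i = F(∂_i)` of a one-form `F = dZ^i ρ_i` of parity `p`, so that
`F = dZ^i F_i (-)^{i p}`. -/
def formValue (p : ZMod 2) (ρ : Idx d s → SuperFn U (Fin s)) (i : Idx d s) : SuperFn U (Fin s) :=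
  ksign (par i) p • ρ i

/-- A vector field acting on functions, `V(f) = V^i ∂_i f`. -/
def applyVec (V : Idx d s → SuperFn U (Fin s)) (f : SuperFn U (Fin s)) : SuperFn U (Fin s) :=
  ∑ i, V i * pd i f

/-- The super Lie bracket of vector fields of parities `p` and `q`:
`[V, W]^i = V(W^i) - (-)^{pq} W(V^i)`. -/
def lieBracket (p q : ZMod 2) (V W : Idx d s → SuperFn U (Fin s)) : Idx d s → SuperFn U (Fin s) :=
  fun i => applyVec V (W i) - ksign p q • applyVec W (V i)

/-- `df = dZ^i ∂_i f`. -/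
def dFun (f : SuperFn U (Fin s)) : Idx d s → SuperFn U (Fin s) := fun i => pd i f

/-- The left exterior derivative of the one-form `dZ^j ρ_j`, which is
`-dZ^j ∧ dZ^i ∂_i ρ_j = dZ^j ∧ dZ^i (1/2) (dρ)_{ij}`; here `dZ^j ∧ dZ^i = -(-)^{ij} dZ^i ∧ dZ^j`
and `(dρ)_{ij} = -(-)^{ij} (dρ)_{ji}`. -/
def dForm (ρ : Idx d s → SuperFn U (Fin s)) : Idx d s → Idx d s → SuperFn U (Fin s) :=
  fun i j => -(pd i (ρ j) - ksign (par i) (par j) • pd j (ρ i))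

/-- The interior product `ι_V ρ = V^i ρ_i` with the one-form `dZ^i ρ_i`. -/
def iotaOne (V ρ : Idx d s → SuperFn U (Fin s)) : SuperFn U (Fin s) := ∑ i, V i * ρ i

/-- The interior product with the two-form `dZ^j ∧ dZ^i (1/2) η_{ij}` of a vector field of parity
`p`: `ι_V η = V^j dZ^i η_{ij} = dZ^i (-)^{i(p+j)} V^j η_{ij}`. -/
def iotaTwo (p : ZMod 2) (V : Idx d s → SuperFn U (Fin s))
    (η : Idx d s → Idx d s → SuperFn U (Fin s)) : Idx d s → SuperFn U (Fin s) :=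
  fun i => ∑ j, ksign (par i) (p + par j) • (V j * η i j)

/-- The Lie derivative of a one-form, `L_V = ι_V d + d ι_V`. -/
def lieForm (p : ZMod 2) (V ρ : Idx d s → SuperFn U (Fin s)) : Idx d s → SuperFn U (Fin s) :=
  iotaTwo p V (dForm ρ) + dFun (iotaOne V ρ)

/-- The Dorfman bracket of pairs of parities `p` and `q`:
`([V₁, V₂], L_{V₁} F₂ - (-)^{pq} ι_{V₂} dF₁)`. -/
def dorfman (p q : ZMod 2) (S₁ S₂ : LocalPair U s) : LocalPair U s where
  vec := lieBracket p q S₁.vec S₂.vec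
  form := lieForm p S₁.vec S₂.form - ksign p q • iotaTwo q S₂.vec (dForm S₁.form)

/-- The canonical inner product of pairs of parities `p` and `q`:
`ι_{V₁} F₂ + (-)^{pq} ι_{V₂} F₁`. -/
def pairing (p q : ZMod 2) (S₁ S₂ : LocalPair U s) : SuperFn U (Fin s) :=
  iotaOne S₁.vec S₂.form + ksign p q • iotaOne S₂.vec S₁.form

end Calculus

/-! ### Local observables of the sigma model

The fields are `Z^i(σ)` and `P_i(σ)`. Local observables at a point `σ` of the string are
superfunctions on the superdomain of `n`-jets, with coordinates `σ` and the derivatives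
`∂_σ^k Z^i`, `∂_σ^k P_i` for `k ≤ n`. -/

section Jets

variable {d s : ℕ}

/-- Even jet coordinates: `none` is `σ`; in `some (φ, k, m)`, `φ = false` stands for `Z` and
`φ = true` for `P`, and `k` is the order of the `σ`-derivative. -/
abbrev JetEven (n d : ℕ) : Type := Option (Bool × Fin (n + 1) × Fin d)

/-- Odd jet coordinates. -/
abbrev JetOdd (n s : ℕ) : Type := Bool × Fin (n + 1) × Fin s

/-- The body of the jet space: the point `(Z^m)` lies in `U`, all other coordinates are free. -/
def jetBody (n : ℕ) (U : Opens (Fin d → ℝ)) : Opens (JetEven n d → ℝ) where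
  carrier := {w | (fun m => w (some (false, 0, m))) ∈ U}
  is_open' := U.isOpen.preimage (continuous_pi fun _ => continuous_apply _)

/-- Local observables depending on `σ`, the fields and their derivatives up to order `n`. -/
abbrev Observable (n : ℕ) (U : Opens (Fin d → ℝ)) (s : ℕ) : Type :=
  SuperFn (jetBody n U) (JetOdd n s)

/-- The index of the coordinate `∂_σ^k Z^i` (for `φ = false`) or `∂_σ^k P_i` (for `φ = true`). -/
def jetIdx {n : ℕ} (φ : Bool) (k : Fin (n + 1)) : Idx d s → JetEven n d ⊕ JetOdd n s
  | .inl m => .inl (some (φ, k, m))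
  | .inr μ => .inr (φ, k, μ)

variable {U : Opens (Fin d → ℝ)}

/-- The jet coordinate `∂_σ^k Z^i` or `∂_σ^k P_i` as an observable. -/
def jetCoord (n : ℕ) (U : Opens (Fin d → ℝ)) (φ : Bool) (k : Fin (n + 1)) (i : Idx d s) :
    Observable n U s :=
  coord (jetBody n U) (jetIdx φ k i)

/-- A superfunction `f` of the target as the observable `f(Z(σ))`. -/
def ofTarget (n : ℕ) : SuperFn U (Fin s) →ₐ[ℝ] Observable n U s :=
  pull (fun m => some (false, 0, m)) (fun μ => (false, 0, μ)) fun _ hw => hw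

/-- An observable of order `n` as an observable of order `m ≥ n`. -/
def lift {n m : ℕ} (h : n ≤ m) : Observable n U s →ₐ[ℝ] Observable m U s :=
  pull (Option.map fun x => (x.1, Fin.castLE (by omega) x.2.1, x.2.2))
    (fun x => (x.1, Fin.castLE (by omega) x.2.1, x.2.2)) fun _ hw => hw

/-- The total derivative `d/dσ`:
`D f = ∂f/∂σ + ∑ (∂_σ^{k+1} Z^i) ∂f/∂(∂_σ^k Z^i) + ∑ (∂_σ^{k+1} P_i) ∂f/∂(∂_σ^k P_i)`. -/
def totalDeriv {n : ℕ} (f : Observable n U s) : Observable (n + 1) U s :=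
  lift (Nat.le_succ n) (pd (.inl none) f) +
    ∑ φ : Bool, ∑ k : Fin (n + 1), ∑ i : Idx d s,
      jetCoord (n + 1) U φ k.succ i * lift (Nat.le_succ n) (pd (jetIdx φ k i) f)

/-- Test functions on the string. -/
abbrev StringTest : Type := 𝓓((⊤ : Opens ℝ), ℝ)

/-- A smooth function of `σ` as an observable. -/
def ofSigma (n : ℕ) (U : Opens (Fin d → ℝ)) (s : ℕ) (ε : ℝ → ℝ) (h : ContDiff ℝ ∞ ε) :
    Observable n U s :=
  ofSmooth ⟨fun w => ε (w.1 none), fun x => ε (x none),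
    (h.comp (contDiff_apply ℝ ℝ none)).contDiffOn, fun _ => rfl⟩

/-- `ε(σ)` as an observable. -/
def testObs (n : ℕ) (U : Opens (Fin d → ℝ)) (s : ℕ) (ε : StringTest) : Observable n U s :=
  ofSigma n U s ε ε.contDiff

/-- `ε'(σ)` as an observable. -/
def testObsDeriv (n : ℕ) (U : Opens (Fin d → ℝ)) (s : ℕ) (ε : StringTest) : Observable n U s :=
  ofSigma n U s (deriv ε) (ContDiff.deriv' (n := ∞) ε.contDiff)

/-- The right variational derivative of the smeared functional `∫ ε(σ₁) f(σ₁) dσ₁` with respect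
to `Z^i(σ)` (`φ = false`) or `P_i(σ)` (`φ = true`), for `f` depending on the fields and their first
derivatives. -/
def varDeriv (f : Observable 1 U s) (ε : StringTest) (φ : Bool) (i : Idx d s) :
    Observable 2 U s :=
  lift (by omega) (testObs 1 U s ε * pdR (jetIdx φ 0 i) f) -
    totalDeriv (testObs 1 U s ε * pdR (jetIdx φ 1 i) f)

/-- Variation of the observable `g` under the field variation `δZ^i = X false i`,
`δP_i = X true i`. -/
def variation (X : Bool → Idx d s → Observable 2 U s) (g : Observable 1 U s) :
    Observable 3 U s :=
  ∑ φ : Bool, ∑ i : Idx d s,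
    (lift (n := 2) (m := 3) (by omega) (X φ i) *
        lift (n := 1) (m := 3) (by omega) (pd (jetIdx φ 0 i) g) +
      totalDeriv (X φ i) * lift (n := 1) (m := 3) (by omega) (pd (jetIdx φ 1 i) g))

/-- Distributions `K(σ₁, σ₂)` in `σ₁`, with values in the local observables at `σ₂`: the test
function `ε` is sent to `∫ dσ₁ ε(σ₁) K(σ₁, σ₂)`. -/
abbrev Kernel (U : Opens (Fin d → ℝ)) (s : ℕ) : Type := StringTest → Observable 3 U s

/-- The kernel `c(σ₂) δ(σ₁ - σ₂)`, so that `ε` is sent to `ε(σ₂) c(σ₂)`. -/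
def deltaKernel (c : Observable 1 U s) : Kernel U s :=
  fun ε => testObs 3 U s ε * lift (by omega) c

/-- The kernel `c(σ₂) δ'(σ₁ - σ₂)`, so that `ε` is sent to `-ε'(σ₂) c(σ₂)`. -/
def deltaPrimeKernel (c : Observable 1 U s) : Kernel U s :=
  fun ε => -(testObsDeriv 3 U s ε * lift (by omega) c)

/-- The equal-time Poisson bracket `{f(σ₁), g(σ₂)}`, that is
`∑_i ∫ dσ (f(σ₁) ←δ/δP_i(σ) · δ→/δZ^i(σ) g(σ₂) - (-)^i f(σ₁) ←δ/δZ^i(σ) · δ→/δP_i(σ) g(σ₂))`,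
smeared with a test function in `σ₁`. It is normalized by
`{P_i(σ₁), Z^j(σ₂)} = δ_i^j δ(σ₁ - σ₂)`. -/
def poissonBracket (f g : Observable 1 U s) : Kernel U s := fun ε =>
  variation (fun φ i => if φ then -(ksign (par i) (par i) • varDeriv f ε false i)
    else varDeriv f ε true i) g

/-- The current `j_{(V,F)} = V^i P_i + F_i ∂_σ Z^i (-)^i` of a pair of parity `p`. -/
def current (p : ZMod 2) (S : LocalPair U s) : Observable 1 U s :=
  ∑ i : Idx d s, (ofTarget 1 (S.vec i) * jetCoord 1 U true 0 i +
    ksign (par i) (par i) • (ofTarget 1 (formValue p S.form i) * jetCoord 1 U false 1 i))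

/-- A current is nilpotent if its Poisson bracket with itself vanishes. -/
def IsNilpotentCurrent (j : Observable 1 U s) : Prop := poissonBracket j j = 0

end Jets

/-! ### Supermanifolds -/

universe u v

/-- A topological space with a sheaf of real superalgebras (the grading is given by the parity
involution). -/
structure SuperSpace where
  body : TopCat.{u}
  sheaf : TopCat.Sheaf (AlgCat.{v} ℝ) body
  parity : sheaf.presheaf ⟶ sheaf.presheaf
  parity_parity : parity ≫ parity = 𝟙 sheaf.presheaf

/-- The superfunctions on an open subset. -/
abbrev SuperSpace.fn (M : SuperSpace.{u, v}) (V : Opens M.body) : Type v :=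
  M.sheaf.presheaf.obj (op V)

/-- Restriction of superfunctions. -/
def SuperSpace.res (M : SuperSpace.{u, v}) {V V' : Opens M.body} (h : V' ≤ V) :
    M.fn V →ₐ[ℝ] M.fn V' :=
  (M.sheaf.presheaf.map (homOfLE h).op).hom

/-- The image of an open subset under a coordinate map. -/
def coordImage {X : TopCat.{u}} {d : ℕ} {S : Opens X} {x : S → (Fin d → ℝ)}
    (hx : Topology.IsOpenEmbedding x) (V : Opens X) : Opens (Fin d → ℝ) :=
  ⟨x '' (Subtype.val ⁻¹' (V : Set X)),
    hx.isOpenMap _ (V.isOpen.preimage continuous_subtype_val)⟩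

theorem coordImage_mono {X : TopCat.{u}} {d : ℕ} {S : Opens X} {x : S → (Fin d → ℝ)}
    (hx : Topology.IsOpenEmbedding x) {V V' : Opens X} (h : V' ≤ V) :
    coordImage hx V' ≤ coordImage hx V :=
  Set.image_mono (Set.preimage_mono h)

/-- A chart of dimension `d|s`: an isomorphism of the restriction of `M` to an open subset with a
superdomain in `ℝ^{d|s}`, given by a homeomorphism onto an open subset of `ℝ^d` and a compatible
isomorphism of sheaves of superalgebras. -/
structure SuperChart (M : SuperSpace.{u, v}) (d s : ℕ) where
  source : Opens M.body
  map : source → (Fin d → ℝ)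
  isOpenEmbedding : Topology.IsOpenEmbedding map
  iso : ∀ V : Opens M.body, V ≤ source →
    (M.fn V ≃ₐ[ℝ] SuperFn (coordImage isOpenEmbedding V) (Fin s))
  iso_res : ∀ (V V' : Opens M.body) (hV : V ≤ source) (h : V' ≤ V) (f : M.fn V),
    iso V' (h.trans hV) (M.res h f) = restrict (coordImage_mono _ h) (iso V hV f)
  iso_parity : ∀ (V : Opens M.body) (hV : V ≤ source) (f : M.fn V),
    iso V hV ((M.parity.app (op V)).hom f) = parityInv _ (Fin s) (iso V hV f)

namespace SuperChart

variable {M : SuperSpace.{u, v}} {d s : ℕ}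

/-- The image in `ℝ^d` of an open subset (of the domain) of the chart. -/
abbrev image (c : SuperChart M d s) (V : Opens M.body) : Opens (Fin d → ℝ) :=
  coordImage c.isOpenEmbedding V

/-- The coordinate domain in `ℝ^d`. -/
abbrev target (c : SuperChart M d s) : Opens (Fin d → ℝ) := c.image c.source

/-- The change of coordinates from `c'` to `c`, as a map of superfunctions on the overlap. -/
def change (c c' : SuperChart M d s) :
    SuperFn (c'.image (c.source ⊓ c'.source)) (Fin s) ≃ₐ[ℝ]
      SuperFn (c.image (c.source ⊓ c'.source)) (Fin s) :=
  (c'.iso _ inf_le_right).symm.trans (c.iso _ inf_le_left)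

end SuperChart

/-- `M` is a smooth supermanifold of dimension `d|s`. -/
structure SuperSpace.IsSupermanifold (M : SuperSpace.{u, v}) (d s : ℕ) : Prop where
  t2 : T2Space M.body
  secondCountable : SecondCountableTopology M.body
  exists_chart : ∀ x : M.body, ∃ c : SuperChart M d s, x ∈ c.source

/-- A section `(V, F)` of `TM ⊕ T^*M` of parity `p`: components in every chart which on overlaps
satisfy `V'^j = V^i ∂_i Z'^j` and, for `F = dZ^i ρ_i = dZ'^j ρ'_j`, `ρ_i = ∂_i Z'^j ρ'_j`. -/
structure GenSection (M : SuperSpace.{u, v}) (d s : ℕ) (p : ZMod 2) where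
  comp : ∀ c : SuperChart M d s, LocalPair c.target s
  homogeneous : ∀ c, (comp c).IsHomogeneous p
  vec_change : ∀ (c c' : SuperChart M d s) (j : Idx d s),
    c.change c' (restrict (coordImage_mono _ inf_le_right) ((comp c').vec j)) =
      ∑ i, restrict (coordImage_mono _ inf_le_left) ((comp c).vec i) *
        pd i (c.change c' (coord _ j))
  form_change : ∀ (c c' : SuperChart M d s) (i : Idx d s),
    restrict (coordImage_mono _ inf_le_left) ((comp c).form i) =
      ∑ j, pd i (c.change c' (coord _ j)) *
        c.change c' (restrict (coordImage_mono _ inf_le_right) ((comp c').form j))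

end SuperSigma

end

noncomputable section

namespace SuperSigma

/-! ### Signs -/

/-! The computation takes place in one chart, with homogeneous components. A current is affine in
its jets: the coefficient of `P_i` is `V^i`, that of `∂_σ Z^i` is `F_i` up to sign, and the
coefficients are functions of `Z` alone. Smearing the first current with `ε` therefore makes it
generate the variation `δZ^i = ε V_1^i`, while `δP_i` is minus a sign times the derivative of the
first current in `Z^i` less the total derivative of `ε ρ_{1,i}`. Inserting this into the second
current, `ε'` arises in exactly two places: from `∂_σ(ε V_1^i)` meeting `ρ_{2,i}`, and from the
integration by parts in `δP_i` meeting `V_2^i`. These two terms form the pairing (`pairing_eq_sum`).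
The terms in `ε` are again linear in `P_j` and `∂_σ Z^j`; once the jets are moved to the right,
their coefficients are the Lie bracket and the one-form of the Dorfman bracket, the latter because
two terms of Cartan's formula cancel (`dorfman_form_apply`, `bracket_summand`). All Koszul signs are
settled by finite case checks on parities.

The inputs are supercommutativity of superfunctions (`superFn_commute_aux`, `HasParity.mul_comm`),
the graded Leibniz rule (`HasParity.pd_mul`), and compatibility of derivatives with pull-back to
jets (`pd_pull`, `pd_pull_of_notMem`).

For an odd section the pairing with itself cancels, so only the `δ` term is left. Test functions
detect its coefficient (`deltaKernel_injective`), and a homogeneous current vanishes only if all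
components do (`current_eq_zero_iff`). Nilpotency is thus the vanishing of the Dorfman square. -/

theorem ksign_zero_left (q : ZMod 2) : ksign 0 q = 1 := by simp [ksign]

theorem ksign_zero_right (q : ZMod 2) : ksign q 0 = 1 := by simp [ksign]

theorem ksign_one_one : ksign 1 1 = -1 := by simp [ksign]

theorem ksign_comm (p q : ZMod 2) : ksign p q = ksign q p := by simp only [ksign, and_comm]

theorem zmod_two_cases (p : ZMod 2) : p = 0 ∨ p = 1 := by revert p; decide

theorem ksign_add_left (p q r : ZMod 2) : ksign (p + q) r = ksign p r * ksign q r := by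
  have h : (1 + 1 : ZMod 2) = 0 := rfl
  rcases zmod_two_cases p with rfl | rfl <;> rcases zmod_two_cases q with rfl | rfl <;>
    rcases zmod_two_cases r with rfl | rfl <;>
    simp [h, ksign_zero_left, ksign_zero_right, ksign_one_one]

theorem ksign_add_right (p q r : ZMod 2) : ksign p (q + r) = ksign p q * ksign p r := by
  rw [ksign_comm, ksign_add_left, ksign_comm q, ksign_comm r]

theorem ksign_mul_self (p q : ZMod 2) : ksign p q * ksign p q = 1 := by
  rcases zmod_two_cases p with rfl | rfl <;> rcases zmod_two_cases q with rfl | rfl <;>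
    simp [ksign_zero_left, ksign_zero_right, ksign_one_one]

theorem ksign_ne_zero (p q : ZMod 2) : ksign p q ≠ 0 := fun h => by
  simpa [h] using ksign_mul_self p q

/-! ### Exterior algebras -/

section Exterior

variable {N N' : Type*} [AddCommGroup N] [Module ℝ N] [AddCommGroup N'] [Module ℝ N']

/-- The parity involution of an exterior algebra. -/
abbrev extInv : ExteriorAlgebra ℝ N →ₐ[ℝ] ExteriorAlgebra ℝ N :=
  CliffordAlgebra.involute (Q := (0 : QuadraticForm ℝ N))

theorem extInv_extInv (x : ExteriorAlgebra ℝ N) : extInv (extInv x) = x :=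
  CliffordAlgebra.involute_involute x

theorem extInv_ι (v : N) : extInv (ExteriorAlgebra.ι ℝ v) = -ExteriorAlgebra.ι ℝ v :=
  CliffordAlgebra.involute_ι v

/-- A vector anticommutes with every generator, so passing it through a product costs one sign per
factor, which is what the involution records. -/
theorem ι_mul_eq_extInv_mul (v : N) (x : ExteriorAlgebra ℝ N) :
    ExteriorAlgebra.ι ℝ v * x = extInv x * ExteriorAlgebra.ι ℝ v := by
  induction x using ExteriorAlgebra.induction with
  | algebraMap r => rw [AlgHom.commutes, Algebra.commutes]
  | ι w =>
    rw [extInv_ι, neg_mul, eq_neg_iff_add_eq_zero, ExteriorAlgebra.ι_add_mul_swap]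
  | mul a b ha hb => rw [map_mul, ← mul_assoc, ha, mul_assoc, hb, mul_assoc]
  | add a b ha hb => rw [map_add, mul_add, add_mul, ha, hb]

/-- Supercommutativity without splitting `y` into homogeneous parts: `x ± extInv x` is twice the
even or odd part of `x`. The even part is central and the odd part passes `y` at the cost of the
involution. -/
theorem extInv_commute (x : ExteriorAlgebra ℝ N) : ∀ y,
    (x + extInv x) * y = y * (x + extInv x) ∧ (x - extInv x) * y = extInv y * (x - extInv x) := by
  induction x using ExteriorAlgebra.induction with
  | algebraMap r =>
    intro y
    rw [AlgHom.commutes, ← map_add, Algebra.commutes]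
    simp
  | ι w =>
    intro y
    rw [extInv_ι, sub_neg_eq_add, add_neg_cancel, add_mul, mul_add, ι_mul_eq_extInv_mul]
    simp
  | mul a b ha hb =>
    intro y
    -- Even is even·even plus odd·odd, and odd is the mixed products. The factor `1/2` corrects for
    -- each bracket being twice a projection.
    have e₁ : a * b + extInv (a * b) = (2⁻¹ : ℝ) • ((a + extInv a) * (b + extInv b) +
        (a - extInv a) * (b - extInv b)) := by
      rw [map_mul]; simp only [mul_add, add_mul, mul_sub, sub_mul]; module
    have e₂ : a * b - extInv (a * b) = (2⁻¹ : ℝ) • ((a + extInv a) * (b - extInv b) +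
        (a - extInv a) * (b + extInv b)) := by
      rw [map_mul]; simp only [mul_add, add_mul, mul_sub, sub_mul]; module
    rw [e₁, e₂]
    generalize a + extInv a = a₀ at *
    generalize a - extInv a = a₁ at *
    generalize b + extInv b = b₀ at *
    generalize b - extInv b = b₁ at *
    rw [smul_mul_assoc, mul_smul_comm, smul_mul_assoc, mul_smul_comm, add_mul, mul_add, add_mul,
      mul_add]
    constructor
    · rw [mul_assoc, (hb y).1, ← mul_assoc, (ha y).1, mul_assoc, mul_assoc, (hb y).2,
        ← mul_assoc a₁, (ha (extInv y)).2, extInv_extInv, mul_assoc y a₁]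
    · rw [mul_assoc, (hb y).2, ← mul_assoc, (ha (extInv y)).1, mul_assoc, mul_assoc, (hb y).1,
        ← mul_assoc a₁, (ha y).2, mul_assoc]
  | add a b ha hb =>
    intro y
    constructor
    · have := congr_arg₂ (· + ·) (ha y).1 (hb y).1
      simp only [← add_mul, ← mul_add] at this
      rw [map_add, add_add_add_comm]
      exact this
    · have := congr_arg₂ (· + ·) (ha y).2 (hb y).2
      simp only [← add_mul, ← mul_add] at this
      rw [map_add, add_sub_add_comm]
      exact this

/-- The left contraction of an exterior algebra by a linear form. -/
abbrev extContract (f : Module.Dual ℝ N) : ExteriorAlgebra ℝ N →ₗ[ℝ] ExteriorAlgebra ℝ N :=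
  CliffordAlgebra.contractLeft (Q := (0 : QuadraticForm ℝ N)) f

theorem extContract_ι (f : Module.Dual ℝ N) (v : N) :
    extContract f (ExteriorAlgebra.ι ℝ v) = algebraMap ℝ _ (f v) :=
  CliffordAlgebra.contractLeft_ι _ _ _

theorem extContract_ι_mul (f : Module.Dual ℝ N) (v : N) (x : ExteriorAlgebra ℝ N) :
    extContract f (ExteriorAlgebra.ι ℝ v * x) = f v • x - ExteriorAlgebra.ι ℝ v * extContract f x :=
  CliffordAlgebra.contractLeft_ι_mul _ _ _

theorem extContract_algebraMap (f : Module.Dual ℝ N) (r : ℝ) :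
    extContract f (algebraMap ℝ _ r) = 0 :=
  CliffordAlgebra.contractLeft_algebraMap _ _ _

/-- Contraction is an antiderivation. The induction prepends one vector at a time, since its
recursion is known for `ι v * a`. -/
theorem extContract_mul (f : Module.Dual ℝ N) (x y : ExteriorAlgebra ℝ N) :
    extContract f (x * y) = extContract f x * y + extInv x * extContract f y := by
  induction x using CliffordAlgebra.left_induction with
  | algebraMap r =>
    rw [← Algebra.smul_def, map_smul, extContract_algebraMap, AlgHom.commutes, zero_mul, zero_add,
      Algebra.smul_def]
  | add a b ha hb => rw [add_mul, map_add, ha, hb, map_add, map_add, add_mul, add_mul]; abel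
  | ι_mul a v ha =>
    change extContract f (ExteriorAlgebra.ι ℝ v * a * y) =
      extContract f (ExteriorAlgebra.ι ℝ v * a) * y +
        extInv (ExteriorAlgebra.ι ℝ v * a) * extContract f y
    rw [mul_assoc, extContract_ι_mul, ha, extContract_ι_mul, map_mul, extInv_ι, mul_add, sub_mul,
      smul_mul_assoc, neg_mul, neg_mul, mul_assoc, mul_assoc]
    abel

theorem extInv_extContract (f : Module.Dual ℝ N) (x : ExteriorAlgebra ℝ N) :
    extInv (extContract f x) = -extContract f (extInv x) := by
  induction x using CliffordAlgebra.left_induction with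
  | algebraMap r => rw [AlgHom.commutes, extContract_algebraMap, map_zero, neg_zero]
  | add a b ha hb => rw [map_add, map_add, ha, hb, map_add, map_add, neg_add]
  | ι_mul a v ha =>
    change extInv (extContract f (ExteriorAlgebra.ι ℝ v * a)) =
      -extContract f (extInv (ExteriorAlgebra.ι ℝ v * a))
    rw [extContract_ι_mul, map_sub, map_mul, ha, map_mul, extInv_ι, neg_mul (ExteriorAlgebra.ι ℝ v)
      (extInv a), map_neg, neg_neg, extContract_ι_mul, map_smul, neg_mul_neg]

theorem extContract_map (f : Module.Dual ℝ N') (l : N →ₗ[ℝ] N') (x : ExteriorAlgebra ℝ N) :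
    extContract f (ExteriorAlgebra.map l x) = ExteriorAlgebra.map l (extContract (f ∘ₗ l) x) := by
  induction x using CliffordAlgebra.left_induction with
  | algebraMap r =>
    rw [AlgHom.commutes, extContract_algebraMap, extContract_algebraMap, map_zero]
  | add a b ha hb => rw [map_add, map_add, map_add, map_add, ha, hb]
  | ι_mul a v ha =>
    change extContract f (ExteriorAlgebra.map l (ExteriorAlgebra.ι ℝ v * a)) =
      ExteriorAlgebra.map l (extContract (f ∘ₗ l) (ExteriorAlgebra.ι ℝ v * a))
    rw [map_mul, ExteriorAlgebra.map_apply_ι, extContract_ι_mul, extContract_ι_mul, ha, map_sub,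
      map_smul, map_mul, ExteriorAlgebra.map_apply_ι]
    rfl

theorem extInv_map (l : N →ₗ[ℝ] N') (x : ExteriorAlgebra ℝ N) :
    extInv (ExteriorAlgebra.map l x) = ExteriorAlgebra.map l (extInv x) := by
  induction x using ExteriorAlgebra.induction with
  | algebraMap r => simp only [AlgHom.commutes]
  | ι w => rw [ExteriorAlgebra.map_apply_ι, extInv_ι, extInv_ι, map_neg,
      ExteriorAlgebra.map_apply_ι]
  | mul a b ha hb => simp only [map_mul, ha, hb]
  | add a b ha hb => simp only [map_add, ha, hb]

end Exterior

/-! ### Smooth functions -/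

section Smooth

variable {α : Type} [Fintype α]

/-- The zero extension need not be smooth outside `W`, but the derivative at a point of the open set
`W` sees only nearby values, so any convenient representative may replace it. -/
theorem smoothDeriv_apply_of_eq [DecidableEq α] {W : Opens (α → ℝ)} (a : α) (f : smoothFn W)
    (g : (α → ℝ) → ℝ) (h : ∀ w : W, g w = f.1 w) (w : W) :
    (smoothDeriv W a f).1 w = fderiv ℝ g w (Pi.single a 1) := by
  change fderiv ℝ (zeroExt f) w (Pi.single a 1) = _
  have : zeroExt f =ᶠ[nhds (w : α → ℝ)] g := by
    filter_upwards [W.isOpen.mem_nhds w.2] with x hx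
    rw [zeroExt_apply f ⟨x, hx⟩, ← h ⟨x, hx⟩]
  rw [this.fderiv_eq]

theorem smoothDeriv_mul [DecidableEq α] {W : Opens (α → ℝ)} (a : α) (f g : smoothFn W) :
    smoothDeriv W a (f * g) = smoothDeriv W a f * g + f * smoothDeriv W a g := by
  ext w
  refine (smoothDeriv_apply_of_eq a (f * g) (fun x => zeroExt f x * zeroExt g x)
    (fun w => by rw [zeroExt_apply, zeroExt_apply]; rfl) w).trans ?_
  rw [fderiv_fun_mul (differentiableAt_zeroExt f w) (differentiableAt_zeroExt g w)]
  change zeroExt f w * fderiv ℝ (zeroExt g) w _ + zeroExt g w * fderiv ℝ (zeroExt f) w _ =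
    fderiv ℝ (zeroExt f) w _ * g.1 w + f.1 w * fderiv ℝ (zeroExt g) w _
  rw [zeroExt_apply, zeroExt_apply]
  ring

variable {α' : Type} [Fintype α'] [DecidableEq α'] {W : Opens (α → ℝ)} {W' : Opens (α' → ℝ)}

theorem smoothDeriv_smoothPull_apply (e : α → α') (h : ∀ w ∈ W', w ∘ e ∈ W) (f : smoothFn W)
    (a' : α') (w : W') : (smoothDeriv W' a' (smoothPull e h f)).1 w =
      fderiv ℝ (zeroExt f) (w ∘ e) ((Pi.single a' 1 : α' → ℝ) ∘ e) := by
  have hd : HasFDerivAt (fun x : α' → ℝ => x ∘ e)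
      (ContinuousLinearMap.pi fun i => ContinuousLinearMap.proj (e i) : (α' → ℝ) →L[ℝ] (α → ℝ))
      (w : α' → ℝ) :=
    (ContinuousLinearMap.pi fun i => ContinuousLinearMap.proj (e i) :
      (α' → ℝ) →L[ℝ] (α → ℝ)).hasFDerivAt
  rw [smoothDeriv_apply_of_eq a' (smoothPull e h f) (zeroExt f ∘ fun x => x ∘ e)
    (fun w => zeroExt_apply f ⟨w.1 ∘ e, h _ w.2⟩) w]
  rw [((differentiableAt_zeroExt f ⟨w.1 ∘ e, h _ w.2⟩).hasFDerivAt.comp (w : α' → ℝ) hd).fderiv]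
  rfl

theorem smoothDeriv_smoothPull [DecidableEq α] {e : α → α'} (he : Function.Injective e)
    (h : ∀ w ∈ W', w ∘ e ∈ W) (f : smoothFn W) (a : α) :
    smoothDeriv W' (e a) (smoothPull e h f) = smoothPull e h (smoothDeriv W a f) := by
  ext w
  rw [smoothDeriv_smoothPull_apply]
  have : (Pi.single (e a) 1 : α' → ℝ) ∘ e = Pi.single a 1 := by
    ext b
    simp [Pi.single_apply, he.eq_iff]
  rw [this]
  rfl

theorem smoothDeriv_smoothPull_of_notMem {e : α → α'} (h : ∀ w ∈ W', w ∘ e ∈ W) (f : smoothFn W)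
    {a' : α'} (ha : a' ∉ Set.range e) : smoothDeriv W' a' (smoothPull e h f) = 0 := by
  ext w
  rw [smoothDeriv_smoothPull_apply]
  have : (Pi.single a' 1 : α' → ℝ) ∘ e = 0 := by
    ext b
    simp only [Function.comp_apply, Pi.single_apply, Pi.zero_apply, ite_eq_right_iff]
    exact fun hb => absurd ⟨b, hb⟩ ha
  rw [this, map_zero]
  rfl

end Smooth

/-! ### Superfunctions -/

section Superdomain

variable {α : Type} [Fintype α] {β : Type} {W : Opens (α → ℝ)}

scoped instance : Ring (SuperFn W β) := Algebra.TensorProduct.instRing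

scoped instance : Algebra ℝ (SuperFn W β) := Algebra.TensorProduct.leftAlgebra

scoped instance : AddCommGroup (SuperFn W β) := Ring.toAddCommGroup

scoped instance : AddGroup (SuperFn W β) := AddCommGroup.toAddGroup

scoped instance : Module ℝ (SuperFn W β) := Algebra.toModule

scoped instance : IsScalarTower ℝ (SuperFn W β) (SuperFn W β) := IsScalarTower.right

scoped instance : SMulCommClass ℝ (SuperFn W β) (SuperFn W β) := Algebra.to_smulCommClass

theorem parityInv_tmul (f : smoothFn W) (x : ExteriorAlgebra ℝ (β →₀ ℝ)) :
    parityInv W β (f ⊗ₜ x) = f ⊗ₜ extInv x := rfl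

theorem parityInv_mul (f g : SuperFn W β) :
    parityInv W β (f * g) = parityInv W β f * parityInv W β g := by
  induction f using TensorProduct.induction_on with
  | zero => simp
  | add f f' hf hf' => rw [add_mul, map_add, map_add, hf, hf', add_mul]
  | tmul f x =>
    induction g using TensorProduct.induction_on with
    | zero => simp
    | add g g' hg hg' => rw [mul_add, map_add, map_add, hg, hg', mul_add]
    | tmul g y =>
      simp only [parityInv_tmul, Algebra.TensorProduct.tmul_mul_tmul, map_mul]

/-- By bilinearity this reduces to pure tensors, where the smooth factors commute and the exterior
factors obey `extInv_commute`. -/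
theorem superFn_commute_aux (f g : SuperFn W β) :
    (f + parityInv W β f) * g = g * (f + parityInv W β f) ∧
      (f - parityInv W β f) * g = parityInv W β g * (f - parityInv W β f) := by
  induction f using TensorProduct.induction_on with
  | zero => simp
  | add f f' hf hf' =>
    rw [map_add, add_add_add_comm, add_sub_add_comm, add_mul, mul_add, hf.1, hf'.1, add_mul,
      mul_add (parityInv W β g), hf.2, hf'.2]
    exact ⟨rfl, rfl⟩
  | tmul f x =>
    induction g using TensorProduct.induction_on with
    | zero => simp
    | add g g' hg hg' =>
      rw [map_add, mul_add (_ + _), mul_add (_ - _), add_mul g, add_mul (parityInv W β g), hg.1,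
        hg'.1, hg.2, hg'.2]
      exact ⟨rfl, rfl⟩
    | tmul g y =>
      rw [parityInv_tmul, parityInv_tmul, ← TensorProduct.tmul_add, ← TensorProduct.tmul_sub]
      simp only [Algebra.TensorProduct.tmul_mul_tmul]
      rw [(extInv_commute x y).1, (extInv_commute x y).2, mul_comm f g]
      exact ⟨rfl, rfl⟩

/-- For homogeneous `f` one of `f ± parityInv f` is `2f`; the matching half of
`superFn_commute_aux`, divided by two, gives the Koszul sign. -/
theorem HasParity.mul_comm {f g : SuperFn W β} {p q : ZMod 2} (hf : HasParity f p)
    (hg : HasParity g q) : f * g = ksign p q • (g * f) := by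
  have h := superFn_commute_aux f g
  have h2 : (2 : ℝ) ≠ 0 := two_ne_zero
  rw [HasParity] at hf hg
  rcases zmod_two_cases p with rfl | rfl
  · rw [hf, ksign_zero_left, one_smul, ← two_smul ℝ f, smul_mul_assoc, mul_smul_comm] at h
    rw [ksign_zero_left, one_smul]
    exact smul_right_injective _ h2 h.1
  · rw [hf, hg, ksign_one_one, neg_one_smul ℝ f, sub_neg_eq_add, ← two_smul ℝ f,
      smul_mul_assoc, mul_smul_comm] at h
    rw [smul_right_injective _ h2 h.2, smul_mul_assoc]
    rcases zmod_two_cases q with rfl | rfl <;>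
      simp only [ksign_zero_right]

theorem HasParity.mul {f g : SuperFn W β} {p q : ZMod 2} (hf : HasParity f p)
    (hg : HasParity g q) : HasParity (f * g) (p + q) := by
  rw [HasParity] at *
  rw [parityInv_mul, hf, hg, smul_mul_smul_comm, ksign_add_left, ksign_add_right, ksign_add_right,
    ksign_comm q p]
  congr 1
  linear_combination (-ksign p p * ksign q q) * ksign_mul_self p q

theorem HasParity.add {f g : SuperFn W β} {p : ZMod 2} (hf : HasParity f p)
    (hg : HasParity g p) : HasParity (f + g) p := by
  rw [HasParity] at *
  rw [map_add, hf, hg, smul_add]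

theorem HasParity.smul {f : SuperFn W β} {p : ZMod 2} (hf : HasParity f p) (r : ℝ) :
    HasParity (r • f) p := by
  rw [HasParity] at *
  rw [map_smul, hf, smul_comm]

theorem HasParity.sum {ι : Type*} {s : Finset ι} {f : ι → SuperFn W β} {p : ZMod 2}
    (hf : ∀ i ∈ s, HasParity (f i) p) : HasParity (∑ i ∈ s, f i) p := by
  rw [HasParity, map_sum, Finset.smul_sum]
  exact Finset.sum_congr rfl hf

theorem hasParity_ofSmooth (f : smoothFn W) : HasParity (ofSmooth f : SuperFn W β) 0 := by
  rw [HasParity, ksign_zero_left, one_smul, ofSmooth, parityInv_tmul, map_one]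

theorem hasParity_coord (i : α ⊕ β) : HasParity (coord W i) (par i) := by
  rcases i with a | b
  · exact hasParity_ofSmooth _
  · rw [HasParity, coord, parityInv_tmul, extInv_ι, TensorProduct.tmul_neg, par, ksign_one_one,
      neg_one_smul ℝ]

theorem ofSmooth_mul_comm (f : smoothFn W) (g : SuperFn W β) :
    ofSmooth f * g = g * ofSmooth f := by
  have h := (superFn_commute_aux (ofSmooth f) g).1
  rw [hasParity_ofSmooth f, ksign_zero_left, one_smul, ← two_smul ℝ, smul_mul_assoc,
    mul_smul_comm] at h
  exact smul_right_injective _ (two_ne_zero (α := ℝ)) h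

/-! ### Graded Leibniz rules and derivatives of coordinates -/

section Derivatives

variable [DecidableEq α]

theorem pd_inl_tmul (a : α) (f : smoothFn W) (x : ExteriorAlgebra ℝ (β →₀ ℝ)) :
    pd (.inl a) (f ⊗ₜ[ℝ] x) = smoothDeriv W a f ⊗ₜ x := rfl

theorem pd_inr_tmul (b : β) (f : smoothFn W) (x : ExteriorAlgebra ℝ (β →₀ ℝ)) :
    pd (.inr b) (f ⊗ₜ[ℝ] x) = f ⊗ₜ extContract (Finsupp.lapply b) x := rfl

theorem pd_inl_mul (a : α) (f g : SuperFn W β) :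
    pd (.inl a) (f * g) = pd (.inl a) f * g + f * pd (.inl a) g := by
  induction f using TensorProduct.induction_on with
  | zero => simp
  | add f f' hf hf' => rw [add_mul, map_add, map_add, hf, hf', add_mul, add_mul]; abel
  | tmul f x =>
    induction g using TensorProduct.induction_on with
    | zero => simp
    | add g g' hg hg' => rw [mul_add, map_add, map_add, hg, hg', mul_add, mul_add]; abel
    | tmul g y =>
      simp only [pd_inl_tmul, Algebra.TensorProduct.tmul_mul_tmul, smoothDeriv_mul,
        TensorProduct.add_tmul]

theorem pd_inr_mul (b : β) (f g : SuperFn W β) :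
    pd (.inr b) (f * g) = pd (.inr b) f * g + parityInv W β f * pd (.inr b) g := by
  induction f using TensorProduct.induction_on with
  | zero => simp
  | add f f' hf hf' =>
    rw [add_mul, map_add, map_add, map_add, hf, hf', add_mul, add_mul]; abel
  | tmul f x =>
    induction g using TensorProduct.induction_on with
    | zero => simp
    | add g g' hg hg' => rw [mul_add, map_add, map_add, hg, hg', mul_add, mul_add]; abel
    | tmul g y =>
      simp only [pd_inr_tmul, parityInv_tmul, Algebra.TensorProduct.tmul_mul_tmul, extContract_mul,
        TensorProduct.tmul_add]

theorem HasParity.pd_mul {f : SuperFn W β} {p : ZMod 2} (hf : HasParity f p) (i : α ⊕ β)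
    (g : SuperFn W β) : pd i (f * g) = pd i f * g + ksign (par i) p • (f * pd i g) := by
  rcases i with a | b
  · rw [pd_inl_mul, par, ksign_zero_left, one_smul]
  · rw [pd_inr_mul, hf, par, smul_mul_assoc]
    rcases zmod_two_cases p with rfl | rfl <;> simp only [ksign_zero_right]

theorem parityInv_pd (i : α ⊕ β) (f : SuperFn W β) :
    parityInv W β (pd i f) = ksign (par i) (par i) • pd i (parityInv W β f) := by
  induction f using TensorProduct.induction_on with
  | zero => simp
  | add f f' hf hf' => simp only [map_add, hf, hf', smul_add]
  | tmul f x =>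
    rcases i with a | b
    · rw [pd_inl_tmul, parityInv_tmul, parityInv_tmul, pd_inl_tmul, par, ksign_zero_left, one_smul]
    · rw [pd_inr_tmul, parityInv_tmul, parityInv_tmul, pd_inr_tmul, extInv_extContract, par,
        ksign_one_one, neg_one_smul ℝ, TensorProduct.tmul_neg]

theorem HasParity.pd {f : SuperFn W β} {p : ZMod 2} (hf : HasParity f p) (i : α ⊕ β) :
    HasParity (pd i f) (p + par i) := by
  have h := parityInv_pd i f
  rw [hf, map_smul, smul_smul] at h
  rw [HasParity, h, ksign_add_left, ksign_add_right, ksign_add_right, ksign_comm (par i) p]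
  congr 1
  linear_combination (-ksign p p * ksign (par i) (par i)) * ksign_mul_self p (par i)

theorem HasParity.pdR_eq {f : SuperFn W β} {p : ZMod 2} (hf : HasParity f p) (i : α ⊕ β) :
    pdR i f = ksign (par i) (p + 1) • SuperSigma.pd i f := by
  rcases i with a | b
  · rw [par, ksign_zero_left, one_smul]; rfl
  · have h := hf.pd (.inr b)
    rw [par] at h
    refine h.trans ?_
    rw [par]
    congr 1
    rcases zmod_two_cases p with rfl | rfl
    · rw [zero_add]
    · rw [show (1 + 1 : ZMod 2) = 0 from rfl, ksign_zero_left, ksign_zero_right]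

theorem smoothDeriv_const (a : α) : smoothDeriv W a 1 = 0 := by
  ext w
  rw [smoothDeriv_apply_of_eq a 1 (fun _ => 1) (fun _ => rfl), fderiv_fun_const]
  rfl

theorem pd_coord_self (i : α ⊕ β) : pd i (coord W i) = 1 := by
  rcases i with a | b
  · rw [coord, ofSmooth, pd_inl_tmul, Algebra.TensorProduct.one_def]
    congr 1
    ext w
    rw [smoothDeriv_apply_of_eq a _ (ContinuousLinearMap.proj (R := ℝ) a)
      (fun _ => rfl), ContinuousLinearMap.fderiv]
    exact Pi.single_eq_same a 1
  · rw [coord, pd_inr_tmul, extContract_ι]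
    simp [Algebra.TensorProduct.one_def]

theorem pd_coord_of_ne {i j : α ⊕ β} (h : i ≠ j) : pd i (coord W j) = 0 := by
  rcases j with a' | b'
  · rcases i with a | b
    · rw [coord, ofSmooth, pd_inl_tmul]
      refine (congr_arg (· ⊗ₜ[ℝ] _) ?_).trans (TensorProduct.zero_tmul _ _)
      ext w
      rw [smoothDeriv_apply_of_eq a _ (ContinuousLinearMap.proj (R := ℝ) a') (fun _ => rfl),
        ContinuousLinearMap.fderiv]
      exact Pi.single_eq_of_ne (fun h' => h (by rw [h'])) 1
    · rw [coord, ofSmooth, pd_inr_tmul, ← map_one (algebraMap ℝ _), extContract_algebraMap,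
        TensorProduct.tmul_zero]
  · rcases i with a | b
    · rw [coord, pd_inl_tmul, smoothDeriv_const, TensorProduct.zero_tmul]
    · rw [coord, pd_inr_tmul, extContract_ι]
      have : b' ≠ b := fun h' => h (by rw [h'])
      simp [this]

theorem pd_inl_ofSmooth (a : α) (f : smoothFn W) :
    pd (.inl a) (ofSmooth f : SuperFn W β) = ofSmooth (smoothDeriv W a f) := rfl

theorem pd_inr_ofSmooth (b : β) (f : smoothFn W) : pd (.inr b) (ofSmooth f : SuperFn W β) = 0 := by
  rw [ofSmooth, pd_inr_tmul, ← map_one (algebraMap ℝ _), extContract_algebraMap,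
    TensorProduct.tmul_zero]

end Derivatives

/-! ### Pull-back along coordinate projections: functoriality, injectivity, chain rule -/

section Pull

variable {α' : Type} [Fintype α'] {β' : Type} {W' : Opens (α' → ℝ)} {e : α → α'} {o : β → β'}
  (h : ∀ w ∈ W', w ∘ e ∈ W)

theorem pull_tmul (f : smoothFn W) (x : ExteriorAlgebra ℝ (β →₀ ℝ)) :
    pull e o h (f ⊗ₜ x) =
      smoothPull e h f ⊗ₜ[ℝ] ExteriorAlgebra.map (Finsupp.lmapDomain ℝ ℝ o) x := rfl

theorem pull_ofSmooth (f : smoothFn W) :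
    pull e o h (ofSmooth f) = ofSmooth (smoothPull e h f) := by
  rw [ofSmooth, pull_tmul, map_one]; rfl

theorem pull_coord (i : α ⊕ β) : pull e o h (coord W i) = coord W' (Sum.map e o i) := by
  rcases i with a | b
  · rw [coord, pull_ofSmooth]; rfl
  · rw [coord, pull_tmul, ExteriorAlgebra.map_apply_ι, map_one]
    simp [coord]

theorem pull_pull {α'' : Type} [Fintype α''] {β'' : Type} {W'' : Opens (α'' → ℝ)} {e' : α' → α''}
    {o' : β' → β''} (h' : ∀ w ∈ W'', w ∘ e' ∈ W') {e'' : α → α''} {o'' : β → β''}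
    (h'' : ∀ w ∈ W'', w ∘ e'' ∈ W) (he : e' ∘ e = e'') (ho : o' ∘ o = o'') (f : SuperFn W β) :
    pull e' o' h' (pull e o h f) = pull e'' o'' h'' f := by
  subst he ho
  induction f using TensorProduct.induction_on with
  | zero => simp
  | add f g hf hg => simp only [map_add, hf, hg]
  | tmul f x =>
    rw [pull_tmul, pull_tmul, pull_tmul, Finsupp.lmapDomain_comp, ← ExteriorAlgebra.map_comp_map]
    rfl

theorem parityInv_pull (f : SuperFn W β) :
    parityInv W' β' (pull e o h f) = pull e o h (parityInv W β f) := by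
  induction f using TensorProduct.induction_on with
  | zero => simp
  | add f g hf hg => simp only [map_add, hf, hg]
  | tmul f x => rw [pull_tmul, parityInv_tmul, parityInv_tmul, pull_tmul, extInv_map]

theorem HasParity.pull {f : SuperFn W β} {p : ZMod 2} (hf : HasParity f p) :
    HasParity (pull e o h f) p := by
  rw [HasParity, parityInv_pull, hf, map_smul]

/-- Over a field every module is flat, so a tensor product of injective maps is injective. The
smooth factor is injective because the projection of bodies is onto, the exterior factor because `o`
is injective on generators. -/
theorem pull_injective (ho : Function.Injective o)
    (hsurj : ∀ w ∈ W, ∃ w' ∈ W', w' ∘ e = w) : Function.Injective (pull e o h) := by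
  refine TensorProduct.map_injective_of_flat_flat (smoothPull e h).toLinearMap
    (ExteriorAlgebra.map (Finsupp.lmapDomain ℝ ℝ o)).toLinearMap ?_ ?_
  · intro f g hfg
    ext w
    obtain ⟨w', hw', hw⟩ := hsurj w.1 w.2
    have := congr_fun (congr_arg Subtype.val hfg) ⟨w', hw'⟩
    have hw'' : (⟨w' ∘ e, h _ hw'⟩ : W) = w := Subtype.ext hw
    change f.1 ⟨w' ∘ e, h _ hw'⟩ = g.1 ⟨w' ∘ e, h _ hw'⟩ at this
    rwa [hw''] at this
  · exact ExteriorAlgebra.map_injective_field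
      (LinearMap.ker_eq_bot.2 (Finsupp.mapDomain_injective ho))

variable [DecidableEq α']

theorem pd_pull [DecidableEq α] (he : Function.Injective e) (ho : Function.Injective o)
    (i : α ⊕ β) (f : SuperFn W β) :
    pd (Sum.map e o i) (pull e o h f) = pull e o h (pd i f) := by
  induction f using TensorProduct.induction_on with
  | zero => simp
  | add f g hf hg => simp only [map_add, hf, hg]
  | tmul f x =>
    rcases i with a | b
    · rw [Sum.map_inl, pull_tmul, pd_inl_tmul, pd_inl_tmul, pull_tmul, smoothDeriv_smoothPull he]
    · rw [Sum.map_inr, pull_tmul, pd_inr_tmul, pd_inr_tmul, pull_tmul, extContract_map]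
      congr 4
      ext c
      simp only [LinearMap.comp_apply, Finsupp.lmapDomain_apply, Finsupp.lsingle_apply,
        Finsupp.mapDomain_single, Finsupp.lapply_apply]
      rw [← Finsupp.mapDomain_single, Finsupp.mapDomain_apply ho]

theorem pd_pull_of_notMem {i : α' ⊕ β'} (hi : i ∉ Set.range (Sum.map e o)) (f : SuperFn W β) :
    pd i (pull e o h f) = 0 := by
  induction f using TensorProduct.induction_on with
  | zero => simp
  | add f g hf hg => simp only [map_add, hf, hg, add_zero]
  | tmul f x =>
    rcases i with a | b
    · rw [pull_tmul, pd_inl_tmul, smoothDeriv_smoothPull_of_notMem h, TensorProduct.zero_tmul]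
      rintro ⟨c, rfl⟩
      exact hi ⟨.inl c, rfl⟩
    · rw [pull_tmul, pd_inr_tmul, extContract_map]
      have : (Finsupp.lapply b : (β' →₀ ℝ) →ₗ[ℝ] ℝ) ∘ₗ Finsupp.lmapDomain ℝ ℝ o = 0 := by
        ext c
        have : o c ≠ b := fun hc => hi ⟨.inr c, congr_arg _ hc⟩
        simp [this]
      rw [this, extContract, map_zero, LinearMap.zero_apply, map_zero, TensorProduct.tmul_zero]

end Pull

/-- A superfunction annihilated by sufficiently many smooth functions vanishes. -/
theorem eq_zero_of_forall_ofSmooth_mul {c : SuperFn W β} {S : Set (smoothFn W)}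
    (hS : ∀ w : W, ∃ f ∈ S, f.1 w ≠ 0) (h : ∀ f ∈ S, ofSmooth f * c = 0) : c = 0 := by
  classical
  -- A basis of the exterior algebra turns `c` into a finite family of smooth coefficients, on which
  -- an even function acts by pointwise multiplication.
  let b := Module.Basis.ofVectorSpace ℝ (ExteriorAlgebra ℝ (β →₀ ℝ))
  let E := TensorProduct.equivFinsuppOfBasisRight (M := smoothFn W) b
  have hE : ∀ (f : smoothFn W) (c : SuperFn W β) k, E (ofSmooth f * c) k = f * E c k := by
    intro f c k
    induction c using TensorProduct.induction_on with
    | zero => simp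
    | add c c' hc hc' => rw [mul_add, map_add, map_add, Finsupp.add_apply, hc, hc',
        Finsupp.add_apply, mul_add]
    | tmul g x =>
      rw [ofSmooth, Algebra.TensorProduct.tmul_mul_tmul, one_mul]
      simp [E]
  apply E.injective
  rw [map_zero]
  ext k w
  obtain ⟨f, hf, hw⟩ := hS w
  have := hE f c k
  rw [h f hf, map_zero, Finsupp.zero_apply] at this
  have := congr_fun (congr_arg Subtype.val this) w
  exact (mul_eq_zero.1 this.symm).resolve_left hw

end Superdomain

/-! ### Jets -/

section Jets

variable {d s : ℕ} {U : Opens (Fin d → ℝ)}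

theorem par_jetIdx {n : ℕ} (φ : Bool) (k : Fin (n + 1)) (i : Idx d s) :
    par (jetIdx φ k i) = par i := by
  rcases i with m | μ <;> rfl

theorem jetIdx_inj {n : ℕ} {φ φ' : Bool} {k k' : Fin (n + 1)} {i i' : Idx d s} :
    jetIdx φ k i = jetIdx φ' k' i' ↔ φ = φ' ∧ k = k' ∧ i = i' := by
  rcases i with m | μ <;> rcases i' with m' | μ' <;> simp [jetIdx]

theorem hasParity_jetCoord (n : ℕ) (φ : Bool) (k : Fin (n + 1)) (i : Idx d s) :
    HasParity (jetCoord n U φ k i) (par i) := by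
  rw [← par_jetIdx φ k i]
  exact hasParity_coord _

theorem HasParity.ofTarget {f : SuperFn U (Fin s)} {p : ZMod 2} (hf : HasParity f p) (n : ℕ) :
    HasParity (ofTarget n f) p :=
  hf.pull _

theorem hasParity_ofSigma (n : ℕ) (ε : ℝ → ℝ) (h : ContDiff ℝ ∞ ε) :
    HasParity (ofSigma n U s ε h) 0 :=
  hasParity_ofSmooth _

theorem lift_ofTarget {n m : ℕ} (h : n ≤ m) (f : SuperFn U (Fin s)) :
    lift h (ofTarget n f) = ofTarget m f :=
  pull_pull _ _ _ rfl rfl f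

theorem lift_jetCoord {n m : ℕ} (h : n ≤ m) (φ : Bool) (k : Fin (n + 1)) (i : Idx d s) :
    lift h (jetCoord n U φ k i) = jetCoord m U φ (Fin.castLE (by omega) k) i := by
  refine (pull_coord _ _).trans ?_
  rcases i with a | b <;> rfl

theorem lift_ofSigma {n m : ℕ} (h : n ≤ m) (ε : ℝ → ℝ) (hε : ContDiff ℝ ∞ ε) :
    lift h (ofSigma n U s ε hε) = ofSigma m U s ε hε :=
  pull_ofSmooth _ _

theorem ofTarget_injective (n : ℕ) : Function.Injective (ofTarget (U := U) (s := s) n) := by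
  refine pull_injective _ (fun a b h => by simpa using h) fun w hw => ?_
  -- A jet over the point `w`: only the order-zero `Z` coordinates matter, the others get arbitrary
  -- values.
  refine ⟨fun x => x.elim 0 fun y => w y.2.2, hw, rfl⟩

theorem lift_injective {n m : ℕ} (h : n ≤ m) :
    Function.Injective (lift (U := U) (s := s) h) := by
  have hinj : Function.Injective fun x : Bool × Fin (n + 1) × Fin d =>
      (x.1, (Fin.castLE (by omega) x.2.1 : Fin (m + 1)), x.2.2) := by
    rintro ⟨a, b, c⟩ ⟨a', b', c'⟩ h
    simpa using h
  refine pull_injective _ (fun ⟨a, b, c⟩ ⟨a', b', c'⟩ h => by simpa using h) fun w hw => ?_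
  -- The new higher jet coordinates are set to zero; the order-zero `Z` coordinates are kept, so the
  -- point stays over `U`.
  refine ⟨Function.extend (Option.map _) w 0, ?_,
    Function.extend_comp (Option.map_injective hinj) w 0⟩
  have key := Function.extend_comp (Option.map_injective hinj) w 0
  change (fun m' => Function.extend (Option.map _) w 0 (some (false, 0, m'))) ∈ U
  have : (fun m' => Function.extend (Option.map fun x : Bool × Fin (n + 1) × Fin d =>
      (x.1, (Fin.castLE (by omega) x.2.1 : Fin (m + 1)), x.2.2)) w 0 (some (false, 0, m'))) =
        fun m' => w (some (false, 0, m')) :=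
    funext fun m' => congr_fun key (some (false, 0, m'))
  rw [this]
  exact hw

theorem pd_jetIdx_jetCoord {n : ℕ} (φ φ' : Bool) (k k' : Fin (n + 1)) (i i' : Idx d s) :
    pd (jetIdx φ k i) (jetCoord n U φ' k' i') = if φ = φ' ∧ k = k' ∧ i = i' then 1 else 0 := by
  split_ifs with h
  · obtain ⟨rfl, rfl, rfl⟩ := h
    exact pd_coord_self _
  · exact pd_coord_of_ne fun h' => h (jetIdx_inj.1 h')

theorem pd_ofTarget {n : ℕ} (i : Idx d s) (f : SuperFn U (Fin s)) :
    pd (jetIdx false 0 i) (ofTarget n f) = ofTarget n (pd i f) := by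
  have h := pd_pull (W := U) (W' := jetBody n U) (e := fun m => some (false, 0, m))
    (o := fun μ : Fin s => ((false, 0, μ) : JetOdd n s)) (fun _ hw => hw)
    (fun a b h => by simpa using h) (fun a b h => by simpa using h) i f
  rcases i with m | μ <;> exact h

theorem pd_none_ofTarget {n : ℕ} (f : SuperFn U (Fin s)) :
    pd (.inl none) (ofTarget n f) = 0 := by
  refine pd_pull_of_notMem _ ?_ f
  rintro ⟨a | b, h⟩ <;> simp at h

theorem pd_ofTarget_of_ne {n : ℕ} {φ : Bool} {k : Fin (n + 1)} (h : ¬(φ = false ∧ k = 0))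
    (i : Idx d s) (f : SuperFn U (Fin s)) : pd (jetIdx φ k i) (ofTarget n f) = 0 := by
  refine pd_pull_of_notMem _ ?_ f
  rintro ⟨j, hj⟩
  have : jetIdx false 0 j = jetIdx φ k i := by rw [← hj]; rcases j with m | μ <;> rfl
  have := jetIdx_inj.1 this
  exact h ⟨this.1.symm, this.2.1.symm⟩

theorem pd_jetIdx_ofSigma {n : ℕ} (φ : Bool) (k : Fin (n + 1)) (i : Idx d s) (ε : ℝ → ℝ)
    (h : ContDiff ℝ ∞ ε) : pd (jetIdx φ k i) (ofSigma n U s ε h) = 0 := by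
  rcases i with m | μ
  · rw [ofSigma, jetIdx, pd_inl_ofSmooth, ofSmooth]
    refine (congr_arg (· ⊗ₜ[ℝ] _) ?_).trans (TensorProduct.zero_tmul _ _)
    ext w
    rw [smoothDeriv_apply_of_eq _ _ (fun x => ε (x none)) (fun _ => rfl)]
    have hd : HasFDerivAt (fun x : JetEven n d → ℝ => ε (x none)) _ w.1 :=
      (h.differentiable (by simp) (w.1 none)).hasFDerivAt.comp w.1
        (ContinuousLinearMap.proj (R := ℝ) (φ := fun _ : JetEven n d => ℝ) none).hasFDerivAt
    rw [hd.fderiv]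
    simp
  · exact pd_inr_ofSmooth _ _

theorem pd_none_ofSigma {n : ℕ} (ε : ℝ → ℝ) (h : ContDiff ℝ ∞ ε) (h' : ContDiff ℝ ∞ (deriv ε)) :
    pd (.inl none) (ofSigma n U s ε h) = ofSigma n U s (deriv ε) h' := by
  rw [ofSigma, pd_inl_ofSmooth, ofSigma]
  congr 1
  ext w
  rw [smoothDeriv_apply_of_eq _ _ (fun x => ε (x none)) (fun _ => rfl)]
  have hd : HasFDerivAt (fun x : JetEven n d → ℝ => ε (x none)) _ w.1 :=
    (h.differentiable (by simp) (w.1 none)).hasFDerivAt.comp w.1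
      (ContinuousLinearMap.proj (R := ℝ) (φ := fun _ : JetEven n d => ℝ) none).hasFDerivAt
  rw [hd.fderiv]
  simp

theorem testObs_mul_comm (n : ℕ) (ε : StringTest) (f : Observable n U s) :
    testObs n U s ε * f = f * testObs n U s ε :=
  ofSmooth_mul_comm _ _

theorem lift_testObs {n m : ℕ} (h : n ≤ m) (ε : StringTest) :
    lift h (testObs n U s ε) = testObs m U s ε :=
  lift_ofSigma _ _ _

theorem lift_testObsDeriv {n m : ℕ} (h : n ≤ m) (ε : StringTest) :
    lift h (testObsDeriv n U s ε) = testObsDeriv m U s ε :=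
  lift_ofSigma _ _ _

theorem pd_jetIdx_testObs_mul {n : ℕ} (φ : Bool) (k : Fin (n + 1)) (i : Idx d s) (ε : StringTest)
    (f : Observable n U s) : pd (jetIdx φ k i) (testObs n U s ε * f) =
      testObs n U s ε * pd (jetIdx φ k i) f := by
  rw [testObs, (hasParity_ofSigma n _ _).pd_mul, pd_jetIdx_ofSigma, zero_mul, zero_add,
    ksign_zero_right, one_smul]

theorem totalDeriv_testObs_mul_ofTarget (n : ℕ) (ε : StringTest) (f : SuperFn U (Fin s)) :
    totalDeriv (testObs n U s ε * ofTarget n f) =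
      testObsDeriv (n + 1) U s ε * ofTarget (n + 1) f +
        testObs (n + 1) U s ε *
          ∑ i, jetCoord (n + 1) U false 1 i * ofTarget (n + 1) (pd i f) := by
  rw [totalDeriv]
  congr 1
  · rw [testObs, pd_inl_mul, pd_none_ofTarget, mul_zero, add_zero,
      pd_none_ofSigma _ _ (ContDiff.deriv' (n := ∞) ε.contDiff), map_mul, lift_ofSigma,
      lift_ofTarget]
    rfl
  · simp only [pd_jetIdx_testObs_mul, Fintype.sum_bool]
    -- `f(Z)` does not involve `P`, which kills the `φ = true` block, nor higher jets of `Z`, which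
    -- leaves only `k = 0`.
    rw [Finset.sum_eq_zero, zero_add, Finset.sum_eq_single 0, Finset.mul_sum]
    · refine Finset.sum_congr rfl fun i _ => ?_
      rw [pd_ofTarget, map_mul, lift_testObs, lift_ofTarget, ← mul_assoc, ← mul_assoc,
        ← testObs_mul_comm, Fin.succ_zero_eq_one]
    · intro k _ hk
      refine Finset.sum_eq_zero fun i _ => ?_
      rw [pd_ofTarget_of_ne (by simp [hk]), mul_zero, map_zero, mul_zero]
    · simp
    · intro k _
      refine Finset.sum_eq_zero fun i _ => ?_
      rw [pd_ofTarget_of_ne (by simp), mul_zero, map_zero, mul_zero]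

theorem totalDeriv_zero (n : ℕ) : totalDeriv (0 : Observable n U s) = 0 := by
  simp [totalDeriv]

/-! ### Injectivity of the delta kernel -/

theorem exists_stringTest_ne_zero (σ : ℝ) : ∃ ε : StringTest, ε σ ≠ 0 := by
  let b : ContDiffBump σ := ⟨1, 2, one_pos, one_lt_two⟩
  refine ⟨⟨b, b.contDiff, b.hasCompactSupport, fun _ _ => trivial⟩, ?_⟩
  change b σ ≠ 0
  rw [b.one_of_mem_closedBall (Metric.mem_closedBall_self zero_le_one)]
  exact one_ne_zero

/-- At every point of the jet space some test function is nonzero at the coordinate `σ`, so the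
smeared products determine all coefficients of the observable. -/
theorem deltaKernel_injective : Function.Injective (deltaKernel (U := U) (s := s)) := by
  intro c c' h
  refine lift_injective (show 1 ≤ 3 by omega) (sub_eq_zero.1 ?_)
  refine eq_zero_of_forall_ofSmooth_mul
    (S := Set.range fun ε : StringTest => (⟨fun w => ε (w.1 none), fun x => ε (x none),
      (ε.contDiff.comp (contDiff_apply ℝ ℝ none)).contDiffOn, fun _ => rfl⟩ :
        smoothFn (jetBody 3 U))) ?_ ?_
  · intro w
    obtain ⟨ε, hε⟩ := exists_stringTest_ne_zero (w.1 none)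
    exact ⟨_, ⟨ε, rfl⟩, hε⟩
  · rintro _ ⟨ε, rfl⟩
    have := congr_fun h ε
    rw [mul_sub, sub_eq_zero]
    exact this

end Jets

/-! ### Derivatives of a current and its brackets in components -/

section Currents

variable {d s : ℕ} {U : Opens (Fin d → ℝ)} {p q : ZMod 2} {S S₁ S₂ : LocalPair U s}

theorem zmod_two_add_self (p : ZMod 2) : p + p = 0 := CharTwo.add_self_eq_zero p

theorem hasParity_formValue (hS : S.IsHomogeneous p) (i : Idx d s) :
    HasParity (formValue p S.form i) (p + par i) :=
  (hS i).2.smul _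

theorem hasParity_current (hS : S.IsHomogeneous p) : HasParity (current p S) p := by
  refine HasParity.sum fun i _ => HasParity.add ?_ (HasParity.smul ?_ _)
  · have := ((hS i).1.ofTarget 1).mul (hasParity_jetCoord (U := U) 1 true 0 i)
    rwa [add_assoc, zmod_two_add_self, add_zero] at this
  · have := ((hasParity_formValue hS i).ofTarget 1).mul (hasParity_jetCoord (U := U) 1 false 1 i)
    rwa [add_assoc, zmod_two_add_self, add_zero] at this

theorem pd_current (hS : S.IsHomogeneous p) (φ : Bool) (k : Fin 2) (i : Idx d s) :
    pd (jetIdx φ k i) (current p S) = ∑ j,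
      (pd (jetIdx φ k i) (ofTarget 1 (S.vec j)) * jetCoord 1 U true 0 j +
        ksign (par i) (p + par j) •
          (ofTarget 1 (S.vec j) * pd (jetIdx φ k i) (jetCoord 1 U true 0 j)) +
        ksign (par j) (par j) •
          (pd (jetIdx φ k i) (ofTarget 1 (formValue p S.form j)) * jetCoord 1 U false 1 j +
            ksign (par i) (p + par j) • (ofTarget 1 (formValue p S.form j) *
              pd (jetIdx φ k i) (jetCoord 1 U false 1 j)))) := by
  rw [current, map_sum]
  refine Finset.sum_congr rfl fun j _ => ?_
  rw [map_add, map_smul, ((hS j).1.ofTarget 1).pd_mul,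
    ((hasParity_formValue hS j).ofTarget 1).pd_mul, par_jetIdx]

/-- The observable `∂_i V^j P_j + (-)^j ∂_i F_j ∂_σ Z^j`. -/
def currentDeriv (n : ℕ) (p : ZMod 2) (S : LocalPair U s) (i : Idx d s) : Observable n U s :=
  ∑ j, (ofTarget n (pd i (S.vec j)) * jetCoord n U true 0 j +
    ksign (par j) (par j) •
      (ofTarget n (pd i (formValue p S.form j)) * jetCoord n U false 1 j))

theorem pd_position_current (hS : S.IsHomogeneous p) (i : Idx d s) :
    pd (jetIdx false 0 i) (current p S) = currentDeriv 1 p S i := by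
  rw [pd_current hS]
  refine Finset.sum_congr rfl fun j _ => ?_
  rw [pd_jetIdx_jetCoord, pd_jetIdx_jetCoord, if_neg (by simp), if_neg (by simp), pd_ofTarget,
    pd_ofTarget]
  simp

/-- Three signs meet and cancel: `(-)^i` in the current, `(-)^{ip}` in `F_i`, and `(-)^{i(p+i)}`
from moving the derivative past `F_i`. The right coefficient stored in the pair is what remains. -/
theorem pd_velocity_current (hS : S.IsHomogeneous p) (i : Idx d s) :
    pd (jetIdx false 1 i) (current p S) = ofTarget 1 (S.form i) := by
  rw [pd_current hS, Finset.sum_eq_single i]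
  · rw [pd_jetIdx_jetCoord, pd_jetIdx_jetCoord, if_neg (by simp), if_pos (by simp),
      pd_ofTarget_of_ne (by simp), pd_ofTarget_of_ne (by simp)]
    simp only [zero_mul, mul_zero, smul_zero, zero_add, mul_one, formValue, map_smul, smul_smul]
    rw [ksign_add_right, show ∀ a b : ℝ, a * (b * a * b) = (a * a) * (b * b) by intros; ring,
      ksign_mul_self, ksign_mul_self, one_mul, one_smul]
  · intro j _ hj
    rw [pd_jetIdx_jetCoord, pd_jetIdx_jetCoord, if_neg (by simp), if_neg (by simp [hj.symm]),
      pd_ofTarget_of_ne (by simp), pd_ofTarget_of_ne (by simp)]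
    simp
  · simp

theorem pd_momentum_current (hS : S.IsHomogeneous p) (i : Idx d s) :
    pd (jetIdx true 0 i) (current p S) =
      ksign (par i) (p + par i) • ofTarget 1 (S.vec i) := by
  rw [pd_current hS, Finset.sum_eq_single i]
  · rw [pd_jetIdx_jetCoord, pd_jetIdx_jetCoord, if_pos (by simp), if_neg (by simp),
      pd_ofTarget_of_ne (by simp), pd_ofTarget_of_ne (by simp)]
    simp
  · intro j _ hj
    rw [pd_jetIdx_jetCoord, pd_jetIdx_jetCoord, if_neg (by simp [hj.symm]), if_neg (by simp),
      pd_ofTarget_of_ne (by simp), pd_ofTarget_of_ne (by simp)]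
    simp
  · simp

theorem pd_momentum_deriv_current (hS : S.IsHomogeneous p) (i : Idx d s) :
    pd (jetIdx true 1 i) (current p S) = 0 := by
  rw [pd_current hS]
  refine Finset.sum_eq_zero fun j _ => ?_
  rw [pd_jetIdx_jetCoord, pd_jetIdx_jetCoord, if_neg (by simp), if_neg (by simp),
    pd_ofTarget_of_ne (by simp), pd_ofTarget_of_ne (by simp)]
  simp

/-- The total `σ`-derivative `∂_σ Z^k ∂_k f` of a superfunction of the target. -/
def targetDeriv (n : ℕ) (f : SuperFn U (Fin s)) : Observable n U s :=
  ∑ k, jetCoord n U false 1 k * ofTarget n (pd k f)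

theorem castLE_one {n m : ℕ} (h : n ≤ m) (hn : 1 ≤ n) :
    Fin.castLE (Nat.succ_le_succ h) (1 : Fin (n + 1)) = 1 := by
  obtain ⟨n, rfl⟩ := Nat.exists_eq_add_of_le' hn
  obtain ⟨m, rfl⟩ := Nat.exists_eq_add_of_le' (hn.trans h)
  rfl

theorem lift_targetDeriv {n m : ℕ} (h : n ≤ m) (hn : 1 ≤ n) (f : SuperFn U (Fin s)) :
    lift h (targetDeriv n f) = targetDeriv m f := by
  rw [targetDeriv, map_sum]
  refine Finset.sum_congr rfl fun k _ => ?_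
  rw [map_mul, lift_jetCoord, lift_ofTarget, castLE_one h hn]

theorem lift_currentDeriv {n m : ℕ} (h : n ≤ m) (hn : 1 ≤ n) (i : Idx d s) :
    lift h (currentDeriv n p S i) = currentDeriv m p S i := by
  rw [currentDeriv, map_sum]
  refine Finset.sum_congr rfl fun k _ => ?_
  rw [map_add, map_smul, map_mul, map_mul, lift_jetCoord, lift_jetCoord, lift_ofTarget,
    lift_ofTarget, castLE_one h hn]
  rfl

theorem totalDeriv_one_testObs_mul_ofTarget (ε : StringTest) (f : SuperFn U (Fin s)) :
    totalDeriv (n := 1) (testObs 1 U s ε * ofTarget 1 f) =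
      testObsDeriv 2 U s ε * ofTarget 2 f + testObs 2 U s ε * targetDeriv 2 f :=
  totalDeriv_testObs_mul_ofTarget 1 ε f

theorem totalDeriv_two_testObs_mul_ofTarget (ε : StringTest) (f : SuperFn U (Fin s)) :
    totalDeriv (n := 2) (testObs 2 U s ε * ofTarget 2 f) =
      testObsDeriv 3 U s ε * ofTarget 3 f + testObs 3 U s ε * targetDeriv 3 f :=
  totalDeriv_testObs_mul_ofTarget 2 ε f

theorem varDeriv_momentum_current (hS : S.IsHomogeneous p) (ε : StringTest) (i : Idx d s) :
    varDeriv (current p S) ε true i = testObs 2 U s ε * ofTarget 2 (S.vec i) := by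
  rw [varDeriv, (hasParity_current hS).pdR_eq, (hasParity_current hS).pdR_eq,
    pd_momentum_current hS, pd_momentum_deriv_current hS, smul_zero, mul_zero, totalDeriv_zero,
    sub_zero, par_jetIdx, map_mul, lift_testObs, smul_smul, map_smul, lift_ofTarget]
  -- The sign turning a left into a right derivative undoes the sign of differentiating past `V^i`.
  have : ksign (par i) (p + 1) * ksign (par i) (p + par i) = 1 := by
    rcases zmod_two_cases p with rfl | rfl <;> rcases zmod_two_cases (par i) with h | h <;>
      simp [h, ksign_zero_left, ksign_zero_right, ksign_one_one, zmod_two_add_self]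
  rw [this, one_smul]

theorem varDeriv_position_current (hS : S.IsHomogeneous p) (ε : StringTest) (i : Idx d s) :
    varDeriv (current p S) ε false i = ksign (par i) (p + 1) •
      (testObs 2 U s ε * currentDeriv 2 p S i - (testObsDeriv 2 U s ε * ofTarget 2 (S.form i) +
        testObs 2 U s ε * targetDeriv 2 (S.form i))) := by
  have h : testObs 1 U s ε * ksign (par i) (p + 1) • ofTarget 1 (S.form i) =
      testObs 1 U s ε * ofTarget 1 (ksign (par i) (p + 1) • S.form i) := by rw [map_smul]
  have h' : targetDeriv 2 (ksign (par i) (p + 1) • S.form i) =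
      ksign (par i) (p + 1) • targetDeriv 2 (S.form i) := by
    simp only [targetDeriv, map_smul, mul_smul_comm, Finset.smul_sum]
  rw [varDeriv, (hasParity_current hS).pdR_eq, (hasParity_current hS).pdR_eq,
    pd_position_current hS, pd_velocity_current hS, par_jetIdx, par_jetIdx, h,
    totalDeriv_one_testObs_mul_ofTarget, map_mul, map_smul, lift_testObs,
    lift_currentDeriv _ le_rfl, h', map_smul, mul_smul_comm, mul_smul_comm,
    mul_smul_comm, smul_sub, smul_add]

theorem variation_eq {X : Bool → Idx d s → Observable 2 U s} {A B : Idx d s → Observable 2 U s}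
    (hA : ∀ i, X false i = A i) (hB : ∀ i, X true i = B i) (g : Observable 1 U s) :
    variation X g = ∑ i : Idx d s,
      (lift (n := 2) (m := 3) (by omega) (A i) *
          lift (n := 1) (m := 3) (by omega) (pd (jetIdx false 0 i) g) +
        totalDeriv (A i) * lift (n := 1) (m := 3) (by omega) (pd (jetIdx false 1 i) g) +
        (lift (n := 2) (m := 3) (by omega) (B i) *
          lift (n := 1) (m := 3) (by omega) (pd (jetIdx true 0 i) g) +
        totalDeriv (B i) * lift (n := 1) (m := 3) (by omega) (pd (jetIdx true 1 i) g))) := by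
  rw [variation, Fintype.sum_bool, add_comm, ← Finset.sum_add_distrib]
  refine Finset.sum_congr rfl fun i _ => ?_
  rw [hA, hB]

set_option maxHeartbeats 1000000 in
theorem poissonBracket_current_apply (h₁ : S₁.IsHomogeneous p) (h₂ : S₂.IsHomogeneous q)
    (ε : StringTest) : poissonBracket (current p S₁) (current q S₂) ε =
      ∑ i, (testObs 3 U s ε * ofTarget 3 (S₁.vec i) * currentDeriv 3 q S₂ i +
          (testObsDeriv 3 U s ε * ofTarget 3 (S₁.vec i) +
            testObs 3 U s ε * targetDeriv 3 (S₁.vec i)) * ofTarget 3 (S₂.form i) -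
        ksign (par i) (p + q + par i) • ((testObs 3 U s ε * currentDeriv 3 p S₁ i -
          (testObsDeriv 3 U s ε * ofTarget 3 (S₁.form i) +
            testObs 3 U s ε * targetDeriv 3 (S₁.form i))) * ofTarget 3 (S₂.vec i))) := by
  rw [poissonBracket, variation_eq (fun i => varDeriv_momentum_current h₁ ε i)
    (fun i => congr_arg (fun x => -(ksign (par i) (par i) • x))
      (varDeriv_position_current h₁ ε i))]
  refine Finset.sum_congr rfl fun i _ => ?_
  -- The factors are the `(-)^i` in the bracket, the right derivative of the first current, and the
  -- momentum derivative of the second.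
  have hs : ksign (par i) (par i) * ksign (par i) (p + 1) * ksign (par i) (q + par i) =
      ksign (par i) (p + q + par i) := by
    rcases zmod_two_cases p with rfl | rfl <;> rcases zmod_two_cases q with rfl | rfl <;>
      rcases zmod_two_cases (par i) with h | h <;>
      simp [h, ksign_zero_left, ksign_zero_right, ksign_one_one, zmod_two_add_self]
  rw [pd_position_current h₂, pd_velocity_current h₂, pd_momentum_current h₂,
    pd_momentum_deriv_current h₂, totalDeriv_two_testObs_mul_ofTarget,
    lift_currentDeriv _ le_rfl, map_zero, mul_zero, add_zero, smul_smul, map_neg, map_smul,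
    map_smul, neg_mul, ← sub_eq_add_neg, smul_mul_smul_comm, hs]
  simp only [map_sub, map_add, map_mul, lift_testObs, lift_testObsDeriv, lift_ofTarget]
  rw [lift_currentDeriv _ one_le_two, lift_targetDeriv _ one_le_two]

/-- In `ι_V d + d ι_V` the terms `V^i ∂_j ρ_i` occur with opposite signs and drop out, leaving four
monomials to match against the bracket. -/
theorem dorfman_form_apply (h₁ : S₁.IsHomogeneous p) (j : Idx d s) :
    (dorfman p q S₁ S₂).form j = ∑ i, (pd j (S₁.vec i) * S₂.form i +
      ksign (par j) p • (S₁.vec i * pd i (S₂.form j)) +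
      (ksign p q * ksign (par j) (q + par i)) • (S₂.vec i * pd j (S₁.form i)) -
      (ksign p q * ksign (par j) q) • (S₂.vec i * pd i (S₁.form j))) := by
  rw [dorfman]
  simp only [lieForm, Pi.sub_apply, Pi.add_apply, Pi.smul_apply, iotaTwo, dFun, dForm, iotaOne,
    map_sum, Finset.smul_sum]
  rw [← Finset.sum_add_distrib, ← Finset.sum_sub_distrib]
  refine Finset.sum_congr rfl fun i _ => ?_
  rw [(h₁ i).1.pd_mul]
  simp only [mul_neg, mul_sub, mul_smul_comm, ksign_add_right]
  have := ksign_mul_self (par j) (par i)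
  match_scalars
  · ring
  · linear_combination ksign (par j) p * this
  · ring
  · ring
  · linear_combination (-ksign p q * ksign (par j) q) * this

end Currents

/-! ### The bracket of currents as a Dorfman bracket and a pairing -/

section Bracket

variable {d s : ℕ} {U : Opens (Fin d → ℝ)} {p q : ZMod 2} {S S₁ S₂ : LocalPair U s}

/-- This is a lifted partial derivative of the current, so the parity is inherited instead of
computed term by term. -/
theorem hasParity_currentDeriv {n : ℕ} (hn : 1 ≤ n) (hS : S.IsHomogeneous p) (i : Idx d s) :
    HasParity (currentDeriv n p S i) (p + par i) := by
  rw [← lift_currentDeriv hn le_rfl, ← pd_position_current hS, ← par_jetIdx (n := 1) false 0 i]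
  exact ((hasParity_current hS).pd _).pull _

theorem targetDeriv_mul_ofTarget {r t : ZMod 2} (n : ℕ) {f g : SuperFn U (Fin s)}
    (hf : HasParity f r) (hg : HasParity g t) : targetDeriv n f * ofTarget n g =
      ∑ k, ksign (par k) (r + par k + t) • (ofTarget n (pd k f * g) * jetCoord n U false 1 k) := by
  rw [targetDeriv, Finset.sum_mul]
  refine Finset.sum_congr rfl fun k _ => ?_
  rw [mul_assoc, ← map_mul]
  exact (hasParity_jetCoord n false 1 k).mul_comm (((hf.pd k).mul hg).ofTarget n)

/-- The signs in the bracket of two currents. -/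
theorem bracket_signs {A : Type*} [AddCommGroup A] [Module ℝ A] (p q i j : ZMod 2)
    (x₁ x₂ x₃ x₄ x₅ x₆ : A) :
    x₁ + ksign j j • ksign j q • x₂ + ksign j (p + i + j + (q + i)) • x₃ -
        ksign i (p + q + i) • (ksign (p + i) (q + i) • (x₄ + ksign j j • ksign j p • x₅) -
          ksign j (p + i + j + (q + i)) • ksign (p + i + j) (q + i) • x₆) =
      x₁ - ksign p q • x₄ + ksign j j • ksign j (p + q) • (x₃ + ksign j p • x₂ +
        (ksign p q * ksign j (q + i)) • x₆ - (ksign p q * ksign j q) • x₅) := by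
  rcases zmod_two_cases p with rfl | rfl <;> rcases zmod_two_cases q with rfl | rfl <;>
    rcases zmod_two_cases i with rfl | rfl <;> rcases zmod_two_cases j with rfl | rfl <;>
    simp only [zmod_two_add_self, add_zero, zero_add, ksign_zero_left, ksign_zero_right,
      ksign_one_one] <;> module

/-- Normal form of the `ε` terms: with every `P_j` and `∂_σ Z^j` moved to the right and the
components of the second vector field to the left, both sides consist of the same six monomials, and
`bracket_signs` compares their signs. -/
theorem bracket_summand (h₁ : S₁.IsHomogeneous p) (h₂ : S₂.IsHomogeneous q) (n : ℕ) (hn : 1 ≤ n)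
    (i : Idx d s) :
    ofTarget n (S₁.vec i) * currentDeriv n q S₂ i +
        targetDeriv n (S₁.vec i) * ofTarget n (S₂.form i) -
        ksign (par i) (p + q + par i) • ((currentDeriv n p S₁ i - targetDeriv n (S₁.form i)) *
          ofTarget n (S₂.vec i)) =
      ∑ j, (ofTarget n (S₁.vec i * pd i (S₂.vec j) - ksign p q • (S₂.vec i * pd i (S₁.vec j))) *
          jetCoord n U true 0 j +
        ksign (par j) (par j) • ksign (par j) (p + q) •
          (ofTarget n (pd j (S₁.vec i) * S₂.form i +
            ksign (par j) p • (S₁.vec i * pd i (S₂.form j)) +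
            (ksign p q * ksign (par j) (q + par i)) • (S₂.vec i * pd j (S₁.form i)) -
            (ksign p q * ksign (par j) q) • (S₂.vec i * pd i (S₁.form j))) *
              jetCoord n U false 1 j)) := by
  rw [sub_mul, (hasParity_currentDeriv hn h₁ i).mul_comm ((h₂ i).1.ofTarget n),
    targetDeriv_mul_ofTarget n (h₁ i).1 (h₂ i).2, targetDeriv_mul_ofTarget n (h₁ i).2 (h₂ i).1,
    currentDeriv, currentDeriv, Finset.mul_sum, Finset.mul_sum, Finset.smul_sum,
    ← Finset.sum_add_distrib, ← Finset.sum_sub_distrib, Finset.smul_sum, ← Finset.sum_sub_distrib]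
  refine Finset.sum_congr rfl fun j _ => ?_
  rw [(((h₁ i).2.pd j)).mul_comm (h₂ i).1, formValue, formValue]
  have := bracket_signs p q (par i) (par j)
    (ofTarget n (S₁.vec i) * ofTarget n (pd i (S₂.vec j)) * jetCoord n U true 0 j)
    (ofTarget n (S₁.vec i) * ofTarget n (pd i (S₂.form j)) * jetCoord n U false 1 j)
    (ofTarget n (pd j (S₁.vec i)) * ofTarget n (S₂.form i) * jetCoord n U false 1 j)
    (ofTarget n (S₂.vec i) * ofTarget n (pd i (S₁.vec j)) * jetCoord n U true 0 j)
    (ofTarget n (S₂.vec i) * ofTarget n (pd i (S₁.form j)) * jetCoord n U false 1 j)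
    (ofTarget n (S₂.vec i) * ofTarget n (pd j (S₁.form i)) * jetCoord n U false 1 j)
  simp only [map_add, map_sub, map_smul, map_mul, add_mul, sub_mul, mul_add, smul_mul_assoc,
    mul_smul_comm, ← mul_assoc]
  exact this

theorem lift_current_dorfman (h₁ : S₁.IsHomogeneous p) (h₂ : S₂.IsHomogeneous q) {n : ℕ}
    (hn : 1 ≤ n) : lift hn (current (p + q) (dorfman p q S₁ S₂)) =
      ∑ i, (ofTarget n (S₁.vec i) * currentDeriv n q S₂ i +
        targetDeriv n (S₁.vec i) * ofTarget n (S₂.form i) -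
        ksign (par i) (p + q + par i) • ((currentDeriv n p S₁ i - targetDeriv n (S₁.form i)) *
          ofTarget n (S₂.vec i))) := by
  -- The bracket sums over the contracted index `i` outside, the current over the free index `j`;
  -- exchanging them exposes the Dorfman components.
  rw [Finset.sum_congr rfl fun i _ => bracket_summand h₁ h₂ n hn i, Finset.sum_comm, current,
    map_sum]
  refine Finset.sum_congr rfl fun j _ => ?_
  have hv : (dorfman p q S₁ S₂).vec j =
      ∑ i, (S₁.vec i * pd i (S₂.vec j) - ksign p q • (S₂.vec i * pd i (S₁.vec j))) := by
    rw [Finset.sum_sub_distrib, ← Finset.smul_sum]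
    rfl
  rw [Finset.sum_add_distrib, ← Finset.sum_mul, ← map_sum, ← hv, ← Finset.smul_sum,
    ← Finset.smul_sum, ← Finset.sum_mul, ← map_sum, ← dorfman_form_apply h₁, map_add, map_smul,
    map_mul, map_mul, lift_jetCoord, lift_jetCoord, lift_ofTarget, lift_ofTarget,
    castLE_one hn le_rfl, formValue, map_smul, smul_mul_assoc]
  rfl

/-- Puts the second term in the order in which the integration by parts produces it, with `ρ_{1,i}`
before `V_2^i`. -/
theorem pairing_eq_sum (h₁ : S₁.IsHomogeneous p) (h₂ : S₂.IsHomogeneous q) :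
    pairing p q S₁ S₂ = ∑ i, (S₁.vec i * S₂.form i +
      ksign (par i) (p + q + par i) • (S₁.form i * S₂.vec i)) := by
  rw [pairing, iotaOne, iotaOne, Finset.smul_sum, ← Finset.sum_add_distrib]
  refine Finset.sum_congr rfl fun i _ => ?_
  rw [(h₁ i).2.mul_comm (h₂ i).1, smul_smul]
  have : ksign p q = ksign (par i) (p + q + par i) * ksign (p + par i) (q + par i) := by
    rcases zmod_two_cases p with rfl | rfl <;> rcases zmod_two_cases q with rfl | rfl <;>
      rcases zmod_two_cases (par i) with h | h <;>
      simp [h, ksign_zero_left, ksign_zero_right, ksign_one_one, zmod_two_add_self]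
  rw [this]

theorem poissonBracket_current (h₁ : S₁.IsHomogeneous p) (h₂ : S₂.IsHomogeneous q) :
    poissonBracket (current p S₁) (current q S₂) =
      deltaKernel (current (p + q) (dorfman p q S₁ S₂)) -
        deltaPrimeKernel (ofTarget 1 (pairing p q S₁ S₂)) := by
  funext ε
  change _ = testObs 3 U s ε * lift (by omega) (current (p + q) (dorfman p q S₁ S₂)) -
    -(testObsDeriv 3 U s ε * lift (by omega) (ofTarget 1 (pairing p q S₁ S₂)))
  rw [poissonBracket_current_apply h₁ h₂, lift_current_dorfman h₁ h₂, lift_ofTarget,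
    pairing_eq_sum h₁ h₂, map_sum, sub_neg_eq_add, Finset.mul_sum, Finset.mul_sum,
    ← Finset.sum_add_distrib]
  refine Finset.sum_congr rfl fun i _ => ?_
  simp only [map_add, map_smul, map_mul, mul_add, add_mul, mul_sub, sub_mul, mul_smul_comm,
    smul_sub, smul_add, mul_assoc]
  abel

/-! ### Nilpotent currents -/

/-- The components are recovered, up to sign, as derivatives of the current in `P_i` and `∂_σ Z^i`,
and `ofTarget` is injective. -/
theorem current_eq_zero_iff (hS : S.IsHomogeneous p) :
    current p S = 0 ↔ S.vec = 0 ∧ S.form = 0 := by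
  constructor
  · intro h
    constructor
    · funext i
      have := pd_momentum_current hS i
      rw [h, map_zero, eq_comm, smul_eq_zero_iff_right (ksign_ne_zero _ _)] at this
      exact (map_eq_zero_iff _ (ofTarget_injective 1)).1 this
    · funext i
      have := pd_velocity_current hS i
      rw [h, map_zero, eq_comm] at this
      exact (map_eq_zero_iff _ (ofTarget_injective 1)).1 this
  · rintro ⟨hv, hf⟩
    refine Finset.sum_eq_zero fun i _ => ?_
    rw [formValue, hv, hf, Pi.zero_apply, smul_zero, map_zero, zero_mul, zero_mul, smul_zero,
      add_zero]

theorem HasParity.applyVec {V : Idx d s → SuperFn U (Fin s)} {f : SuperFn U (Fin s)} {r : ZMod 2}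
    (hV : ∀ i, HasParity (V i) (p + par i)) (hf : HasParity f r) :
    HasParity (applyVec V f) (p + r) := by
  refine HasParity.sum fun i _ => ?_
  have := (hV i).mul (hf.pd i)
  rwa [add_add_add_comm, zmod_two_add_self, add_zero] at this

theorem HasParity.sub {f g : SuperFn U (Fin s)} {r : ZMod 2} (hf : HasParity f r)
    (hg : HasParity g r) : HasParity (f - g) r := by
  rw [HasParity] at *
  rw [map_sub, hf, hg, smul_sub]

theorem dorfman_isHomogeneous (h₁ : S₁.IsHomogeneous p) (h₂ : S₂.IsHomogeneous q) :
    (dorfman p q S₁ S₂).IsHomogeneous (p + q) := by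
  intro j
  constructor
  · have h := HasParity.applyVec (fun i => (h₂ i).1) (h₁ j).1
    rw [← add_assoc, add_comm q p] at h
    refine HasParity.sub ?_ (h.smul _)
    rw [add_assoc]
    exact HasParity.applyVec (fun i => (h₁ i).1) (h₂ j).1
  -- The summed index `i` enters each monomial twice, so it drops out of the parity modulo 2.
  · have e₁ : ∀ p q i j : ZMod 2, p + i + j + (q + i) = p + q + j := by decide
    have e₂ : ∀ p q i j : ZMod 2, p + i + (q + j + i) = p + q + j := by decide
    have e₃ : ∀ p q i j : ZMod 2, q + i + (p + i + j) = p + q + j := by decide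
    have t₁ := fun i => ((h₁ i).1.pd j).mul (h₂ i).2
    have t₂ := fun i => (h₁ i).1.mul ((h₂ j).2.pd i)
    have t₃ := fun i => (h₂ i).1.mul ((h₁ i).2.pd j)
    have t₄ := fun i => (h₂ i).1.mul ((h₁ j).2.pd i)
    simp only [e₁, e₂, e₃] at t₁ t₂ t₃ t₄
    simp only [add_comm q p] at t₄
    rw [dorfman_form_apply h₁]
    exact HasParity.sum fun i _ =>
      (((t₁ i).add ((t₂ i).smul _)).add ((t₃ i).smul _)).sub ((t₄ i).smul _)

theorem deltaKernel_zero : deltaKernel (0 : Observable 1 U s) = 0 := by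
  funext ε
  rw [deltaKernel, map_zero, mul_zero]
  rfl

theorem isNilpotentCurrent_iff (hS : S.IsHomogeneous 1) :
    IsNilpotentCurrent (current 1 S) ↔ lieBracket 1 1 S.vec S.vec = 0 ∧
      lieForm 1 S.vec S.form + iotaTwo 1 S.vec (dForm S.form) = 0 := by
  -- For two equal odd arguments the pairing is the difference of two identical terms, so there is
  -- no `δ'` contribution.
  have hp : deltaPrimeKernel (ofTarget 1 (pairing 1 1 S S)) = 0 := by
    rw [pairing, ksign_one_one, neg_one_smul, add_neg_cancel, map_zero]
    funext ε
    rw [deltaPrimeKernel, map_zero, mul_zero, neg_zero]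
    rfl
  have hform : (dorfman 1 1 S S).form = lieForm 1 S.vec S.form + iotaTwo 1 S.vec (dForm S.form) := by
    rw [dorfman, ksign_one_one, neg_one_smul, sub_neg_eq_add]
  rw [IsNilpotentCurrent, poissonBracket_current hS hS, hp, sub_zero, ← deltaKernel_zero,
    deltaKernel_injective.eq_iff, current_eq_zero_iff (dorfman_isHomogeneous hS hS), hform]
  rfl

end Bracket

end SuperSigma

end

theorem mainTheorem5 {d s : ℕ} (M : SuperSigma.SuperSpace) (hM : M.IsSupermanifold d s) :
    (∀ (p₁ p₂ : ZMod 2) (S₁ : SuperSigma.GenSection M d s p₁)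
        (S₂ : SuperSigma.GenSection M d s p₂) (c : SuperSigma.SuperChart M d s),
      SuperSigma.poissonBracket (SuperSigma.current p₁ (S₁.comp c))
          (SuperSigma.current p₂ (S₂.comp c)) =
        SuperSigma.deltaKernel
            (SuperSigma.current (p₁ + p₂)
              (SuperSigma.dorfman p₁ p₂ (S₁.comp c) (S₂.comp c))) -
          SuperSigma.deltaPrimeKernel
            (SuperSigma.ofTarget 1
              (SuperSigma.pairing p₁ p₂ (S₁.comp c) (S₂.comp c)))) ∧
    (∀ (S : SuperSigma.GenSection M d s 1) (c : SuperSigma.SuperChart M d s),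
      SuperSigma.IsNilpotentCurrent (SuperSigma.current 1 (S.comp c)) ↔
        SuperSigma.lieBracket 1 1 (S.comp c).vec (S.comp c).vec = 0 ∧
          SuperSigma.lieForm 1 (S.comp c).vec (S.comp c).form +
            SuperSigma.iotaTwo 1 (S.comp c).vec (SuperSigma.dForm (S.comp c).form) = 0) := by
  exact ⟨fun _ _ S₁ S₂ c =>
      SuperSigma.poissonBracket_current (S₁.homogeneous c) (S₂.homogeneous c),
    fun S c => SuperSigma.isNilpotentCurrent_iff (S.homogeneous c)⟩
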